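/- Let $Q$ be a probability distribution on $\mathbb{R}$ with expectation $0$, variance $1$ and finite fourth moment $b=\int x^4\,dQ(x)$. For natural numbers $n\ge m\ge 0$ let $X(n,m)$ be a random $n\times m$ matrix whose entries are i.i.d. real random variables with distribution $Q$, and for $\mu,\nu\in\mathbb{R}$ put $$f(n,m;\mu,\nu):=\mathbb{E}\bigl(\det(X(n,m)^TX(n,m)-\mu)\,\det(X(n,m)^TX(n,m)-\nu)\bigr),$$ the second-order correlation function of the characteristic polynomial of the (unrescaled) real sample covariance matrix. Fix an integer $\alpha\ge 0$, let $J_\alpha$ be the Bessel function of the first kind of order $\alpha$, and let $\widetilde{\mathbb{J}}_\alpha$ be the "differentiated" Bessel kernel, given for $x,y\in[0,\infty)$, $x\ne y$, by $$\widetilde{\mathbb{J}}_\alpha(x,y):=\frac{(x+y)\bigl(J_\alpha(\sqrt x)\sqrt y\,J_\alpha'(\sqrt y)-\sqrt x\,J_\alpha'(\sqrt x)J_\alpha(\sqrt y)\bigr)}{2(x-y)^3}-\frac{(x+y-2\alpha^2)J_\alpha(\sqrt x)J_\alpha(\sqrt y)+2\sqrt{xy}\,J_\alpha'(\sqrt x)J_\alpha'(\sqrt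 y)}{4(x-y)^2}$$ and for $x=y$ by the limit of this expression through off-diagonal points of $[0,\infty)^2$. Then this limit exists for every $x=y\in[0,\infty)$, $\widetilde{\mathbb{J}}_\alpha$ is continuous on $[0,\infty)^2$, and for all $\mu,\nu\in[0,\infty)$ and all $N$ the expectation $f\bigl(N,\max(N-\alpha,0);\tfrac{\mu}{4N},\tfrac{\nu}{4N}\bigr)$ exists as an absolutely convergent integral (for $N=0$ the matrix is empty and the determinants are $1$). Moreover, with $Z_N(\mu,\nu):=(\mu\nu/N^2)^{\alpha/2}$ (where $0^0:=1$), $$\lim_{N\to\infty}\left(\frac{1}{16}\,N^{-2}\,Z_N(\mu/4,\nu/4)\cdot\frac{f\bigl(N,N-\alpha;\tfrac{\mu}{4N},\tfrac{\nu}{4N}\bigr)}{N!\,(N-\alpha)!}\right)=e^{\,b-3}\,\widetilde{\mathbb{J}}_\alpha(\mu,\nu).$$ -/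

import Mathlib

open MeasureTheory ProbabilityTheory Filter Topology

/-- The rows and columns of `X` are indexed by `Fin n` and `Fin m`; the `n * m` entries of the
random matrix `X` are independent real random variables, each with distribution `Q`. -/
structure IsIIDMatrix {Ω : Type*} [MeasurableSpace Ω] (P : Measure Ω) (Q : Measure ℝ)
    {n m : ℕ} (X : Ω → Matrix (Fin n) (Fin m) ℝ) : Prop where
  hasLaw : ∀ i j, HasLaw (fun ω => X ω i j) Q P
  indep : iIndepFun (fun (p : Fin n × Fin m) (ω : Ω) => X ω p.1 p.2) P

/-- The product `det (XᵀX - μ) * det (XᵀX - ν)` of two values of the characteristic polynomial of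
the unrescaled real sample covariance matrix `XᵀX`. -/
def charProduct {n m : ℕ} (X : Matrix (Fin n) (Fin m) ℝ) (μ ν : ℝ) : ℝ :=
  (X.transpose * X - μ • (1 : Matrix (Fin m) (Fin m) ℝ)).det *
    (X.transpose * X - ν • (1 : Matrix (Fin m) (Fin m) ℝ)).det

/-- The second-order correlation function `f(n, m; μ, ν)` of the characteristic polynomial of the
unrescaled real sample covariance matrix: the expectation of `det (XᵀX - μ) * det (XᵀX - ν)`. -/
noncomputable def correlation {Ω : Type*} [MeasurableSpace Ω] (P : Measure Ω)
    {n m : ℕ} (X : Ω → Matrix (Fin n) (Fin m) ℝ) (μ ν : ℝ) : ℝ :=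
  ∫ ω, charProduct (X ω) μ ν ∂P

/-- The Bessel function of the first kind `J_α` of order `α ∈ ℕ` on the real line. -/
noncomputable def besselFirst (α : ℕ) (x : ℝ) : ℝ :=
  ∑' k : ℕ, (-1 : ℝ) ^ k / ((k.factorial : ℝ) * ((k + α).factorial : ℝ)) * (x / 2) ^ (2 * k + α)

/-- The closed formula for the "differentiated" Bessel kernel; meaningful for `x ≠ y`. -/
noncomputable def diffBesselFormula (α : ℕ) (x y : ℝ) : ℝ :=
  (x + y) * (besselFirst α √x * √y * deriv (besselFirst α) √y
      - √x * deriv (besselFirst α) √x * besselFirst α √y) / (2 * (x - y) ^ 3)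
    - ((x + y - 2 * (α : ℝ) ^ 2) * besselFirst α √x * besselFirst α √y
      + 2 * √(x * y) * deriv (besselFirst α) √x * deriv (besselFirst α) √y) / (4 * (x - y) ^ 2)

open scoped Classical in
/-- The "differentiated" Bessel kernel on `[0, ∞) × [0, ∞)`: the closed formula off the diagonal,
and on the diagonal its limit through off-diagonal points of `[0, ∞) × [0, ∞)`. -/
noncomputable def diffBesselKernel (α : ℕ) (x y : ℝ) : ℝ :=
  if x = y then
    limUnder (𝓝[{p : ℝ × ℝ | 0 ≤ p.1 ∧ 0 ≤ p.2 ∧ p.1 ≠ p.2}] (x, x))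
      (fun p => diffBesselFormula α p.1 p.2)
  else diffBesselFormula α x y

/-- The normalizing factor `Z_N(μ, ν) = (μ ν / N ^ 2) ^ (α / 2)`. -/
noncomputable def hardEdgeFactor (α N : ℕ) (μ ν : ℝ) : ℝ :=
  (μ * ν / (N : ℝ) ^ 2) ^ ((α : ℝ) / 2)

/-! The correlation function is computed exactly for every matrix size, and then its coefficients
converge. Let `a` be the characteristic polynomial of `W = YᵀY` and `B(x)` the adjugate of `x - W`.
Adding a row `r` to `Y` replaces `a(x)` by `a(x) - rᵀ B(x) r`. Averaging the product at `x` and `y`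
over `r` needs only the fourth-order moments: three Wick pairings plus a correction by the fourth
cumulant `κ = b - 3`. Since `tr B = a'` and, by the resolvent identity, `tr B(x)B(y) = -D(a(x)a(y))`
with `D = (∂₁ - ∂₂)/(x - y)`, the Wick part is the operator `G = (1 - ∂₁)(1 - ∂₂) - 2D`. The
cumulant part contains `B_kk`, the characteristic polynomial after deletion of column `k`. Hence the
averages satisfy `c(n+1, m) = G c(n, m) + κ m c(n, m-1)`, starting from `c(0, m) = (xy)^m`
(`meanCoeff_succ`, `meanCoeff_eq`).

Two algebraic facts solve this recursion. The two summands commute, so the binomial theorem expands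
`c(n, m)` in powers of `κ` (`correlationCoeff_eq`). On symmetric arrays `G D² = D² (1 - ∂₁)(1 - ∂₂)`
(`gaussStep_divDiff_divDiff`), and `(xy)^m` is a multiple of `D² (xy)^(m+2)`; hence `G^n (xy)^m` is
a multiple of `D²` applied to a product of two Laguerre-type polynomials `(1 - d/dx)^n x^(m+2)`.

At the scale `1/(4N)` the normalised Laguerre coefficients tend to those of a Bessel-type function
`f` of order `α - 2`. Two derivatives raise the order to `α`, so `D²(f(x)f(y))` is the
differentiated Bessel kernel up to the factor `16 (xy/16)^(α/2)` (`diffBesselFormula_eq`). This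
series is continuous across the diagonal, which yields the diagonal values. The `k`-th cumulant term
tends to `κ^k/k!` times the same limit, and dominated convergence sums these to `e^κ`
(`tendsto_tsum_cumulantTerm`). -/

/-! ### Bivariate coefficient arrays -/

/-- A bivariate formal power series, given by its coefficients. -/
abbrev CoeffArray := ℕ → ℕ → ℝ

namespace CoeffArray

/-- The partial derivative in the first variable. -/
def pd₁ : CoeffArray →ₗ[ℝ] CoeffArray where
  toFun c i j := (i + 1) * c (i + 1) j
  map_add' a b := by ext i j; simp; ring
  map_smul' r a := by ext i j; simp; ring

/-- The partial derivative in the second variable. -/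
def pd₂ : CoeffArray →ₗ[ℝ] CoeffArray where
  toFun c i j := (j + 1) * c i (j + 1)
  map_add' a b := by ext i j; simp; ring
  map_smul' r a := by ext i j; simp; ring

/-- Multiplication by the first variable. -/
def mulFst (c : CoeffArray) : CoeffArray
  | 0, _ => 0
  | i + 1, j => c i j

/-- Multiplication by the second variable. -/
def mulSnd (c : CoeffArray) : CoeffArray
  | _, 0 => 0
  | i, j + 1 => c i j

/-- Multiplication by the difference of the two variables. -/
def mulDiff (c : CoeffArray) : CoeffArray := mulFst c - mulSnd c

/-- The operator `(∂₁ - ∂₂) / (x - y)`, which is well-behaved on symmetric arrays. -/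
def divDiff : CoeffArray →ₗ[ℝ] CoeffArray where
  toFun c i j := -∑ s ∈ Finset.range (i + 1), (pd₁ c - pd₂ c) s (i + j + 1 - s)
  map_add' a b := by
    ext i j
    simp only [map_add, Pi.add_apply, Pi.sub_apply, ← neg_add, ← Finset.sum_add_distrib]
    congr 1
    exact Finset.sum_congr rfl fun _ _ => by ring
  map_smul' r a := by
    ext i j
    simp only [map_smul, Pi.smul_apply, Pi.sub_apply, smul_eq_mul, RingHom.id_apply, mul_neg,
      Finset.mul_sum, mul_sub]

/-- An array is symmetric if its generating function is. -/
def IsSymm (c : CoeffArray) : Prop := ∀ i j, c i j = c j i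

/-- The array of the product `a(x) b(y)`. -/
def tensor (a b : ℕ → ℝ) : CoeffArray := fun i j => a i * b j

lemma pd₁_apply (c : CoeffArray) (i j : ℕ) : pd₁ c i j = (i + 1) * c (i + 1) j := rfl
lemma pd₂_apply (c : CoeffArray) (i j : ℕ) : pd₂ c i j = (j + 1) * c i (j + 1) := rfl
lemma divDiff_apply (c : CoeffArray) (i j : ℕ) :
    divDiff c i j = -∑ s ∈ Finset.range (i + 1), (pd₁ c - pd₂ c) s (i + j + 1 - s) := rfl

/-- Division by `x - y` is unambiguous for power series, so identities for `divDiff` can be checked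
after multiplication by `x - y`. -/
lemma mulDiff_injective : Function.Injective mulDiff := by
  intro a b h
  have key : ∀ i j, a i j = b i j := by
    intro i
    induction i with
    | zero =>
      intro j
      have := congrFun (congrFun h 0) (j + 1)
      simpa [mulDiff, mulFst, mulSnd] using this
    | succ i ih =>
      intro j
      have := congrFun (congrFun h (i + 1)) (j + 1)
      simpa [mulDiff, mulFst, mulSnd, ih] using this
  ext i j
  exact key i j

lemma mulDiff_sub (a b : CoeffArray) : mulDiff (a - b) = mulDiff a - mulDiff b := by
  ext i j
  rcases i with _ | i <;> rcases j with _ | j <;> simp [mulDiff, mulFst, mulSnd] <;> ring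

lemma mulDiff_neg (a : CoeffArray) : mulDiff (-a) = -mulDiff a := by
  ext i j
  rcases i with _ | i <;> rcases j with _ | j <;> simp [mulDiff, mulFst, mulSnd] <;> ring

lemma pd₁_mulDiff (c : CoeffArray) : pd₁ (mulDiff c) = mulDiff (pd₁ c) + c := by
  ext i j
  rcases i with _ | i <;> rcases j with _ | j <;> simp [mulDiff, mulFst, mulSnd, pd₁_apply] <;> ring

lemma pd₂_mulDiff (c : CoeffArray) : pd₂ (mulDiff c) = mulDiff (pd₂ c) - c := by
  ext i j
  rcases i with _ | i <;> rcases j with _ | j <;> simp [mulDiff, mulFst, mulSnd, pd₂_apply] <;> ring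

lemma pd₁_pd₂ (c : CoeffArray) : pd₁ (pd₂ c) = pd₂ (pd₁ c) := by
  ext i j
  simp only [pd₁_apply, pd₂_apply]; ring

lemma IsSymm.pd_sub_antisymm {c : CoeffArray} (hc : c.IsSymm) (i j : ℕ) :
    (pd₁ c - pd₂ c) i j = -(pd₁ c - pd₂ c) j i := by
  simp only [Pi.sub_apply, pd₁_apply, pd₂_apply, hc i (j + 1), hc (i + 1) j]; ring

/-- Dividing `p` by `x - y` means solving `h (i-1) j - h i (j-1) = p i j` along each antidiagonal,
which forces the partial sums in `divDiff`. The recursion closes up at `j = 0` exactly when the full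
antidiagonal sum of `p` vanishes; for `p = ∂₁c - ∂₂c` this is antisymmetry. -/
lemma mulDiff_divDiff {c : CoeffArray} (hc : c.IsSymm) :
    mulDiff (divDiff c) = pd₁ c - pd₂ c := by
  -- Reversing the antidiagonal changes the sign of the sum.
  have hsum : ∀ d, ∑ s ∈ Finset.range (d + 1), (pd₁ c - pd₂ c) s (d - s) = 0 := by
    intro d
    have h1 := Finset.sum_range_reflect (fun s => (pd₁ c - pd₂ c) s (d - s)) (d + 1)
    have h2 : ∑ s ∈ Finset.range (d + 1), (pd₁ c - pd₂ c) (d + 1 - 1 - s) (d - (d + 1 - 1 - s))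
        = -∑ s ∈ Finset.range (d + 1), (pd₁ c - pd₂ c) s (d - s) := by
      rw [← Finset.sum_neg_distrib]
      refine Finset.sum_congr rfl fun s hs => ?_
      have : s ≤ d := Nat.lt_succ_iff.mp (Finset.mem_range.mp hs)
      rw [hc.pd_sub_antisymm, Nat.add_sub_cancel, Nat.sub_sub_self this]
    linarith
  ext i j
  rcases j with _ | j
  · rcases i with _ | i
    · have := hc.pd_sub_antisymm 0 0
      simp only [mulDiff, mulFst, mulSnd, Pi.sub_apply] at this ⊢
      linarith
    · have := hsum (i + 1)
      rw [Finset.sum_range_succ, Nat.sub_self] at this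
      have h2 : mulDiff (divDiff c) (i + 1) 0 = divDiff c i 0 := by
        simp [mulDiff, mulFst, mulSnd]
      rw [h2, divDiff_apply]
      simp only [add_zero]
      linarith
  · rcases i with _ | i
    · simp [mulDiff, mulFst, mulSnd, divDiff_apply]
    · have h2 : mulDiff (divDiff c) (i + 1) (j + 1) = divDiff c i (j + 1) - divDiff c (i + 1) j := by
        simp [mulDiff, mulFst, mulSnd]
      rw [h2, divDiff_apply, divDiff_apply, Finset.sum_range_succ _ (i + 1)]
      have e1 : i + (j + 1) + 1 = i + 1 + j + 1 := by ring
      have e2 : i + 1 + j + 1 - (i + 1) = j + 1 := by omega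
      rw [e1, e2]; ring

lemma IsSymm.divDiff {c : CoeffArray} (hc : c.IsSymm) : (divDiff c).IsSymm := by
  have hflip : ∀ a : CoeffArray, mulDiff (fun i j => a j i) = fun i j => -mulDiff a j i := by
    intro a
    ext i j
    rcases i with _ | i <;> rcases j with _ | j <;> simp [mulDiff, mulFst, mulSnd]
  have : (fun i j => CoeffArray.divDiff c j i) = CoeffArray.divDiff c := by
    apply mulDiff_injective
    rw [hflip, mulDiff_divDiff hc]
    ext i j
    rw [hc.pd_sub_antisymm i j]
  intro i j
  exact (congrFun (congrFun this i) j).symm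

lemma IsSymm.pd {c : CoeffArray} (hc : c.IsSymm) : (pd₁ (pd₂ c)).IsSymm := fun i j => by
  simp only [pd₁_apply, pd₂_apply, hc (i + 1) (j + 1)]; ring

lemma pd₁_sub_pd₂_comm (c : CoeffArray) :
    pd₁ (pd₁ c - pd₂ c) - pd₂ (pd₁ c - pd₂ c) =
      pd₁ (pd₁ c) - (2 : ℝ) • pd₁ (pd₂ c) + pd₂ (pd₂ c) := by
  simp only [map_sub, pd₁_pd₂, two_smul]; abel

/-- The commutator of `∂₁∂₂` with multiplication by `x - y` is `-(∂₁ - ∂₂)`. Applied to `divDiff c`,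
it leaves one extra `divDiff` after division by `x - y`. -/
lemma pd_divDiff {c : CoeffArray} (hc : c.IsSymm) :
    pd₁ (pd₂ (divDiff c)) = divDiff (pd₁ (pd₂ c)) + divDiff (divDiff c) := by
  have e := mulDiff_divDiff hc
  apply mulDiff_injective
  have h1 : mulDiff (divDiff (pd₁ (pd₂ c)) + divDiff (divDiff c)) =
      mulDiff (divDiff (pd₁ (pd₂ c))) + mulDiff (divDiff (divDiff c)) := by
    rw [← sub_neg_eq_add, mulDiff_sub, mulDiff_neg, sub_neg_eq_add]
  rw [h1, mulDiff_divDiff hc.pd, mulDiff_divDiff hc.divDiff]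
  have h2 := pd₁_mulDiff (pd₂ (divDiff c))
  have h3 := congrArg pd₁ (pd₂_mulDiff (divDiff c))
  rw [map_sub, h2, e] at h3
  have h4 : mulDiff (pd₁ (pd₂ (divDiff c))) =
      pd₁ (pd₂ (pd₁ c - pd₂ c)) - pd₂ (divDiff c) + pd₁ (divDiff c) := by
    rw [h3]; abel
  rw [h4]
  simp only [map_sub, pd₁_pd₂]; abel

lemma pd_add_divDiff {c : CoeffArray} (hc : c.IsSymm) :
    pd₁ (divDiff c) + pd₂ (divDiff c) = divDiff (pd₁ c + pd₂ c) := by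
  have e := mulDiff_divDiff hc
  have hs : (pd₁ c + pd₂ c).IsSymm := fun i j => by
    simp only [Pi.add_apply, pd₁_apply, pd₂_apply, hc (i + 1) j, hc i (j + 1)]; ring
  apply mulDiff_injective
  rw [mulDiff_divDiff hs]
  have h1 : mulDiff (pd₁ (divDiff c) + pd₂ (divDiff c)) =
      mulDiff (pd₁ (divDiff c)) + mulDiff (pd₂ (divDiff c)) := by
    rw [← sub_neg_eq_add, mulDiff_sub, mulDiff_neg, sub_neg_eq_add]
  have h2 := pd₁_mulDiff (divDiff c)
  have h3 := pd₂_mulDiff (divDiff c)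
  rw [e] at h2 h3
  rw [h1, ← sub_eq_iff_eq_add.mpr h2, ← add_eq_of_eq_sub h3]
  simp only [map_sub, map_add, pd₁_pd₂]; abel

/-! ### Row operators, their intertwining, and Laguerre polynomials -/

/-- The operator `(1 - ∂₁) (1 - ∂₂)`. -/
def freeStep : CoeffArray →ₗ[ℝ] CoeffArray :=
  (LinearMap.id - pd₁) ∘ₗ (LinearMap.id - pd₂)

/-- The operator `(1 - ∂₁) (1 - ∂₂) - 2 (∂₁ - ∂₂) / (x - y)`: the effect of one more Gaussian row
on the correlation function. -/
def gaussStep : CoeffArray →ₗ[ℝ] CoeffArray := freeStep - (2 : ℝ) • divDiff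

lemma freeStep_eq (c : CoeffArray) : freeStep c = c - (pd₁ c + pd₂ c) + pd₁ (pd₂ c) := by
  simp only [freeStep, LinearMap.comp_apply, LinearMap.sub_apply, LinearMap.id_apply, map_sub]; abel

lemma gaussStep_eq (c : CoeffArray) :
    gaussStep c = c - (pd₁ c + pd₂ c) + pd₁ (pd₂ c) - (2 : ℝ) • divDiff c := by
  simp only [gaussStep, LinearMap.sub_apply, LinearMap.smul_apply, freeStep_eq]

/-- Write `D` for `divDiff`. Moving `∂₁∂₂` past two copies of `D` produces `2 D³`, which cancels the
term `-2D` of `gaussStep`; `∂₁ + ∂₂` commutes with `D`. This cancellation is why precisely two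
copies of `D` are needed. -/
lemma gaussStep_divDiff_divDiff {c : CoeffArray} (hc : c.IsSymm) :
    gaussStep (divDiff (divDiff c)) = divDiff (divDiff (freeStep c)) := by
  rw [gaussStep_eq, freeStep_eq, pd_add_divDiff hc.divDiff, pd_add_divDiff hc,
    pd_divDiff hc.divDiff, pd_divDiff hc]
  simp only [map_add, map_sub, two_smul]; abel

lemma tensor_isSymm (a : ℕ → ℝ) : (tensor a a).IsSymm := fun _ _ => mul_comm _ _

lemma freeStep_tensor (a b : ℕ → ℝ) :
    freeStep (tensor a b) =
      tensor (fun i => a i - (i + 1) * a (i + 1)) (fun i => b i - (i + 1) * b (i + 1)) := by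
  ext i j
  simp only [freeStep_eq, tensor, Pi.add_apply, Pi.sub_apply, pd₁_apply, pd₂_apply]; ring

/-- The array of the monomial `(x y) ^ m`. -/
def diagMonomial (m : ℕ) : CoeffArray := tensor (Pi.single m 1) (Pi.single m 1)

lemma divDiff_diagMonomial (m : ℕ) :
    divDiff (diagMonomial (m + 1)) = (-(m + 1 : ℝ)) • diagMonomial m := by
  apply mulDiff_injective
  rw [mulDiff_divDiff (c := diagMonomial (m + 1)) (tensor_isSymm _)]
  ext i j
  rcases i with _ | i <;> rcases j with _ | j <;>
    simp [diagMonomial, tensor, mulDiff, mulFst, mulSnd, pd₁_apply, pd₂_apply, Pi.single_apply] <;>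
    split_ifs <;> first | omega | (subst_vars; push_cast; ring)

/-- The coefficients of `(1 - d/dx) ^ n x ^ M`. -/
noncomputable def laguerreCoeff (n M i : ℕ) : ℝ :=
  if i ≤ M then (-1) ^ (M - i) * (n.choose (M - i) : ℝ) * M.factorial / i.factorial else 0

lemma laguerreCoeff_zero (M : ℕ) : laguerreCoeff 0 M = Pi.single M 1 := by
  ext i
  rcases lt_trichotomy i M with h | h | h
  · have : M - i ≠ 0 := by omega
    simp [laguerreCoeff, h.le, h.ne, Nat.choose_eq_zero_of_lt (Nat.pos_of_ne_zero this)]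
  · subst h
    have : (i.factorial : ℝ) ≠ 0 := by positivity
    simp [laguerreCoeff, this]
  · simp [laguerreCoeff, h.not_ge, h.ne']

lemma laguerreCoeff_succ (n M i : ℕ) :
    laguerreCoeff (n + 1) M i = laguerreCoeff n M i - (i + 1) * laguerreCoeff n M (i + 1) := by
  have hi : (i.factorial : ℝ) ≠ 0 := by positivity
  have hi2 : (i + 1 : ℝ) ≠ 0 := by positivity
  rcases lt_trichotomy i M with h | h | h
  · obtain ⟨k, rfl⟩ : ∃ k, M = i + 1 + k := ⟨M - (i + 1), by omega⟩
    have h1 : i + 1 + k - i = k + 1 := by omega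
    have h2 : i + 1 + k - (i + 1) = k := by omega
    simp only [laguerreCoeff, h1, h2, show i ≤ i + 1 + k by omega,
      show i + 1 ≤ i + 1 + k by omega, if_true, Nat.choose_succ_succ, Nat.factorial_succ i]
    push_cast
    field_simp
    ring
  · subst h
    simp [laguerreCoeff]
  · simp [laguerreCoeff, h.not_ge, show ¬ (i + 1 ≤ M) by omega]

lemma gaussStep_pow_divDiff_divDiff (n M : ℕ) :
    (gaussStep ^ n) (divDiff (divDiff (diagMonomial M))) =
      divDiff (divDiff (tensor (laguerreCoeff n M) (laguerreCoeff n M))) := by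
  induction n with
  | zero => simp [laguerreCoeff_zero, diagMonomial]
  | succ n ih =>
    rw [pow_succ', Module.End.mul_apply, ih, gaussStep_divDiff_divDiff (tensor_isSymm _),
      freeStep_tensor]
    congr 3 <;> · ext i; rw [laguerreCoeff_succ]

/-- Up to a scalar, `(xy)^m` is the double `divDiff` of `(xy)^(m+2)`, so the intertwining relation
replaces `gaussStep` by an operator that acts on each variable separately. -/
lemma gaussStep_pow_diagMonomial (n m : ℕ) :
    (gaussStep ^ n) (diagMonomial m) = ((m + 1) * (m + 2) : ℝ)⁻¹ •
      divDiff (divDiff (tensor (laguerreCoeff n (m + 2)) (laguerreCoeff n (m + 2)))) := by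
  have h : divDiff (divDiff (diagMonomial (m + 2))) =
      ((m + 1) * (m + 2) : ℝ) • diagMonomial m := by
    rw [divDiff_diagMonomial, map_smul, divDiff_diagMonomial, smul_smul]
    congr 1; push_cast; ring
  rw [← gaussStep_pow_divDiff_divDiff, h, map_smul, smul_smul, inv_mul_cancel₀ (by positivity),
    one_smul]

/-! ### Expansion in powers of the fourth cumulant -/

/-- The coefficient array of the correlation function of an `n × m` matrix whose entries have
fourth cumulant `κ`. -/
def correlationCoeff (κ : ℝ) : ℕ → ℕ → CoeffArray
  | 0, m => diagMonomial m
  | n + 1, m => gaussStep (correlationCoeff κ n m) + (κ * m) • correlationCoeff κ n (m - 1)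

lemma correlationCoeff_eq (κ : ℝ) (n m : ℕ) :
    correlationCoeff κ n m = ∑ k ∈ Finset.range (n + 1),
      (n.choose k * m.descFactorial k * κ ^ k : ℝ) •
        (gaussStep ^ (n - k)) (diagMonomial (m - k)) := by
  -- The recursion in `n` is the iteration of `S + L` on sequences indexed by `m`. The truncated `m
  -- - 1` at `m = 0` is harmless because of the factor `m`.
  let L : Module.End ℝ (ℕ → CoeffArray) :=
    { toFun := fun v m => gaussStep (v m)
      map_add' := fun a b => by ext m; simp
      map_smul' := fun r a => by ext m; simp }
  let S : Module.End ℝ (ℕ → CoeffArray) :=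
    { toFun := fun v m => (κ * m) • v (m - 1)
      map_add' := fun a b => by ext m i j; simp; ring
      map_smul' := fun r a => by ext m i j; simp; ring }
  have hcomm : Commute S L := by
    apply LinearMap.ext; intro v
    funext m
    change (κ * m) • gaussStep (v (m - 1)) = gaussStep ((κ * m) • v (m - 1))
    rw [map_smul]
  have hG : ∀ n m, correlationCoeff κ n m = ((S + L) ^ n) diagMonomial m := by
    intro n
    induction n with
    | zero => intro m; rfl
    | succ n ih =>
      intro m
      rw [pow_succ', Module.End.mul_apply]
      change _ = (κ * m) • ((S + L) ^ n) diagMonomial (m - 1) +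
        gaussStep (((S + L) ^ n) diagMonomial m)
      rw [← ih, ← ih, correlationCoeff, add_comm]
  have hL : ∀ k (v : ℕ → CoeffArray) m, (L ^ k) v m = (gaussStep ^ k) (v m) := by
    intro k
    induction k with
    | zero => intro v m; rfl
    | succ k ih =>
      intro v m
      rw [pow_succ, Module.End.mul_apply, ih, pow_succ, Module.End.mul_apply]
      rfl
  have hS : ∀ k (v : ℕ → CoeffArray) m,
      (S ^ k) v m = (m.descFactorial k * κ ^ k : ℝ) • v (m - k) := by
    intro k
    induction k with
    | zero => intro v m; simp
    | succ k ih =>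
      intro v m
      rw [pow_succ, Module.End.mul_apply, ih]
      change _ • (κ * ((m - k : ℕ) : ℝ)) • v (m - k - 1) = _
      rw [smul_smul, Nat.descFactorial_succ, Nat.sub_sub]
      congr 1; push_cast; ring
  rw [hG, hcomm.add_pow]
  simp only [LinearMap.sum_apply, Finset.sum_apply]
  refine Finset.sum_congr rfl fun k _ => ?_
  have : ((n.choose k : ℕ) : Module.End ℝ (ℕ → CoeffArray)) =
      algebraMap ℝ _ (n.choose k : ℝ) := by simp
  rw [Module.End.mul_apply, Module.End.mul_apply, hS, hL, this, Module.algebraMap_end_apply,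
    Pi.smul_apply, map_smul, smul_smul]
  congr 1; ring

end CoeffArray

/-! ### Characteristic polynomials under rank-one perturbations -/

section CharacteristicPolynomial

open Polynomial
open scoped Matrix

variable {ι : Type*} [Fintype ι] [DecidableEq ι]

lemma Matrix.det_add_vecMulVec_of_isUnit {R : Type*} [CommRing R] {A : Matrix ι ι R}
    (hA : IsUnit A.det) (u v : ι → R) :
    (A + vecMulVec u v).det = A.det + v ⬝ᵥ A.adjugate *ᵥ u := by
  rw [vecMulVec_eq Unit, det_add_replicateCol_mul_replicateRow (ι := Unit) hA,
    det_unique (n := Unit), Matrix.inv_def]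
  have h : (1 + replicateRow Unit v * Ring.inverse A.det • A.adjugate * replicateCol Unit u :
      Matrix Unit Unit R) default default = 1 + Ring.inverse A.det * (v ⬝ᵥ A.adjugate *ᵥ u) := by
    rw [Matrix.mul_smul, Matrix.smul_mul, Matrix.mul_assoc]
    simp [Matrix.mul_apply, dotProduct, mulVec]
  rw [h, mul_add, mul_one, ← mul_assoc, Ring.mul_inverse_cancel _ hA, one_mul]

/-- A characteristic matrix has monic, hence nonzero, determinant that need not be a unit in `ℝ[X]`;
the invertible case is applied over the fraction field. -/
lemma Matrix.det_add_vecMulVec_of_ne_zero {R : Type*} [CommRing R] [IsDomain R]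
    {A : Matrix ι ι R} (hA : A.det ≠ 0) (u v : ι → R) :
    (A + vecMulVec u v).det = A.det + v ⬝ᵥ A.adjugate *ᵥ u := by
  let f := algebraMap R (FractionRing R)
  have hf : Function.Injective f := IsFractionRing.injective R (FractionRing R)
  have hdet : IsUnit (f.mapMatrix A).det := by
    rw [← RingHom.map_det, isUnit_iff_ne_zero]
    exact (map_ne_zero_iff f hf).mpr hA
  have h := Matrix.det_add_vecMulVec_of_isUnit hdet (fun i => f (u i)) (fun i => f (v i))
  apply hf
  rw [map_add, RingHom.map_det, RingHom.map_det, map_add]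
  have e1 : f.mapMatrix (vecMulVec u v) = vecMulVec (fun i => f (u i)) (fun i => f (v i)) := by
    ext i j; simp [vecMulVec_apply]
  rw [e1, h, ← RingHom.map_adjugate]
  simp [dotProduct, mulVec, map_sum]

/-- The adjugate of the characteristic matrix. -/
noncomputable def Matrix.charAdjugate (W : Matrix ι ι ℝ) : Matrix ι ι ℝ[X] := W.charmatrix.adjugate

lemma Matrix.charpoly_add_vecMulVec (W : Matrix ι ι ℝ) (u v : ι → ℝ) (i : ℕ) :
    (W + vecMulVec u v).charpoly.coeff i =
      W.charpoly.coeff i - ∑ p : ι × ι, v p.1 * u p.2 * (W.charAdjugate p.1 p.2).coeff i := by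
  have h1 : (W + vecMulVec u v).charmatrix =
      W.charmatrix + vecMulVec (fun i => -C (u i)) (fun i => C (v i)) := by
    ext1 i j
    simp [charmatrix, vecMulVec_apply]; ring
  rw [Matrix.charpoly, h1, Matrix.det_add_vecMulVec_of_ne_zero W.charpoly_monic.ne_zero,
    coeff_add, sub_eq_add_neg, ← Finset.sum_neg_distrib, Fintype.sum_prod_type]
  simp only [dotProduct, mulVec, Finset.mul_sum, finsetSum_coeff]
  congr 1
  refine Finset.sum_congr rfl fun k _ => Finset.sum_congr rfl fun l _ => ?_
  rw [coeff_C_mul, mul_neg, coeff_neg, coeff_mul_C, Matrix.charAdjugate]; ring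

/-- Jacobi's formula: only diagonal entries of `X - W` depend on `X`, each with derivative `1`, so
differentiating the Leibniz expansion gives the diagonal cofactors. -/
lemma Matrix.derivative_charpoly (W : Matrix ι ι ℝ) :
    derivative W.charpoly = W.charAdjugate.trace := by
  have hentry : ∀ i j, derivative (W.charmatrix i j) = if i = j then 1 else 0 := by
    intro i j
    by_cases h : i = j
    · subst h; simp
    · simp [h]
  rw [Matrix.charpoly, det_apply, map_sum, Matrix.trace]
  simp only [Matrix.diag_apply, Matrix.charAdjugate, adjugate_apply]
  simp_rw [det_apply]
  rw [Finset.sum_comm]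
  refine Finset.sum_congr rfl fun σ _ => ?_
  rw [← Finset.smul_sum, Units.smul_def, Units.smul_def, map_zsmul, derivative_prod_finset]
  congr 1
  -- In the Leibniz product the updated row `σ k` is met at the factor `k`, which becomes `1` if `σ
  -- k = k` and `0` otherwise: the derivative of that entry.
  rw [← Equiv.sum_comp σ (fun x => ∏ i, W.charmatrix.updateRow x (Pi.single x 1) (σ i) i)]
  refine Finset.sum_congr rfl fun k _ => ?_
  rw [← Finset.mul_prod_erase _ _ (Finset.mem_univ k), hentry, updateRow_self, mul_comm]
  congr 1
  · by_cases h : σ k = k <;> simp [h]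
  · refine Finset.prod_congr rfl fun i hi => ?_
    rw [updateRow_ne]
    exact fun h => (Finset.mem_erase.mp hi).1 (σ.injective h)

lemma Matrix.sum_charAdjugate_coeff (W : Matrix ι ι ℝ) (i : ℕ) :
    ∑ k, (W.charAdjugate k k).coeff i = (i + 1) * W.charpoly.coeff (i + 1) := by
  have := congrArg (fun p => p.coeff i) W.derivative_charpoly
  simp only [coeff_derivative, Matrix.trace, Matrix.diag_apply, finsetSum_coeff] at this
  rw [← this]; ring

lemma Matrix.X_mul_charAdjugate (W : Matrix ι ι ℝ) (k l : ι) :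
    X * W.charAdjugate k l =
      ∑ p, C (W k p) * W.charAdjugate p l + if k = l then W.charpoly else 0 := by
  have h := congrFun (congrFun (mul_adjugate W.charmatrix) k) l
  rw [← sub_eq_iff_eq_add']
  simpa [Matrix.charAdjugate, charmatrix, sub_mul, Matrix.mul_apply, Matrix.charpoly,
    Matrix.one_apply, Matrix.diagonal_apply, Finset.sum_sub_distrib] using h

lemma Matrix.charAdjugate_mul_X (W : Matrix ι ι ℝ) (k l : ι) :
    X * W.charAdjugate k l =
      ∑ p, W.charAdjugate k p * C (W p l) + if k = l then W.charpoly else 0 := by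
  have h := congrFun (congrFun (adjugate_mul W.charmatrix) k) l
  rw [← sub_eq_iff_eq_add', mul_comm]
  simpa [Matrix.charAdjugate, charmatrix, mul_sub, Matrix.mul_apply, Matrix.charpoly,
    Matrix.one_apply, Matrix.diagonal_apply, Finset.sum_sub_distrib] using h

open CoeffArray in
/-- The resolvent identity for adjugates. -/
lemma Matrix.sum_charAdjugate_mul (W : Matrix ι ι ℝ) (i j : ℕ) :
    ∑ p : ι × ι, (W.charAdjugate p.1 p.2).coeff i * (W.charAdjugate p.2 p.1).coeff j =
      -divDiff (tensor W.charpoly.coeff W.charpoly.coeff) i j := by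
  set B := W.charAdjugate with hB
  set a := W.charpoly.coeff with ha
  let G : CoeffArray := fun i j => ∑ k, ∑ l, (B k l).coeff i * (B l k).coeff j
  have hfst : ∀ i j, mulFst G i j = ∑ k, ∑ l, (X * B k l).coeff i * (B l k).coeff j := by
    intro i j; cases i <;> simp [mulFst, G]
  have hsnd : ∀ i j, mulSnd G i j = ∑ k, ∑ l, (B k l).coeff i * (X * B l k).coeff j := by
    intro i j; cases j <;> simp [mulSnd, G]
  -- After multiplication by `x - y`, substitute `x B(x) = W B(x) + a(x)` in one factor and `y B(y)
  -- = B(y) W + a(y)` in the other. The terms with `W` cancel by cyclicity of the trace (`e3`), and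
  -- traces of `B` are derivatives of `a`.
  have key : G = -divDiff (tensor a a) := by
    apply mulDiff_injective
    rw [mulDiff_neg, mulDiff_divDiff (tensor_isSymm a)]
    ext i j
    have e1 : mulFst G i j = ∑ k, ∑ l, ∑ p, W k p * (B p l).coeff i * (B l k).coeff j +
        a i * ∑ k, (B k k).coeff j := by
      rw [hfst, Finset.mul_sum, ← Finset.sum_add_distrib]
      refine Finset.sum_congr rfl fun k _ => ?_
      rw [hB]
      simp only [X_mul_charAdjugate, coeff_add, finsetSum_coeff, coeff_C_mul, add_mul,
        Finset.sum_add_distrib, Finset.sum_mul]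
      congr 1
      rw [Finset.sum_eq_single k (fun l _ h => by simp [h.symm]) (by simp)]
      simp [ha]
    have e2 : mulSnd G i j = ∑ k, ∑ l, ∑ p, (B k l).coeff i * ((B l p).coeff j * W p k) +
        (∑ k, (B k k).coeff i) * a j := by
      rw [hsnd, Finset.sum_mul, ← Finset.sum_add_distrib]
      refine Finset.sum_congr rfl fun k _ => ?_
      rw [hB]
      simp only [charAdjugate_mul_X, coeff_add, finsetSum_coeff, coeff_mul_C, mul_add,
        Finset.sum_add_distrib, Finset.mul_sum]
      congr 1
      rw [Finset.sum_eq_single k (fun l _ h => by simp [h]) (by simp)]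
      simp [ha]
    have e3 : ∑ k, ∑ l, ∑ p, W k p * (B p l).coeff i * (B l k).coeff j =
        ∑ k, ∑ l, ∑ p, (B k l).coeff i * ((B l p).coeff j * W p k) := by
      calc _ = ∑ k, ∑ p, ∑ l, W k p * (B p l).coeff i * (B l k).coeff j :=
            Finset.sum_congr rfl fun k _ => Finset.sum_comm
        _ = ∑ p, ∑ k, ∑ l, W k p * (B p l).coeff i * (B l k).coeff j := Finset.sum_comm
        _ = ∑ p, ∑ l, ∑ k, W k p * (B p l).coeff i * (B l k).coeff j :=
            Finset.sum_congr rfl fun k _ => Finset.sum_comm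
        _ = _ := Finset.sum_congr rfl fun _ _ => Finset.sum_congr rfl fun _ _ =>
            Finset.sum_congr rfl fun _ _ => by ring
    have e4 : mulDiff G i j = a i * ∑ k, (B k k).coeff j - (∑ k, (B k k).coeff i) * a j := by
      rw [mulDiff, Pi.sub_apply, Pi.sub_apply, e1, e2, e3]; ring
    rw [e4]
    simp only [Pi.sub_apply, Pi.neg_apply, hB, sum_charAdjugate_coeff, pd₁_apply, pd₂_apply,
      tensor, ha]
    ring
  rw [Fintype.sum_prod_type]
  exact congrFun (congrFun key i) j

lemma Matrix.charAdjugate_symm {W : Matrix ι ι ℝ} (hW : W.IsSymm) (k l : ι) :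
    W.charAdjugate k l = W.charAdjugate l k := by
  have h : W.charmatrixᵀ = W.charmatrix := by rw [← charmatrix_transpose, hW.eq]
  have := adjugate_transpose W.charmatrix
  rw [h] at this
  exact congrFun (congrFun this l) k

lemma Matrix.charAdjugate_diag {m : ℕ} (W : Matrix (Fin (m + 1)) (Fin (m + 1)) ℝ)
    (k : Fin (m + 1)) :
    W.charAdjugate k k = (W.submatrix k.succAbove k.succAbove).charpoly := by
  rw [Matrix.charAdjugate, adjugate_fin_succ_eq_det_submatrix, ← two_mul, pow_mul]
  simp only [even_two, Even.neg_pow, one_pow, one_mul, Matrix.charpoly]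
  congr 1
  ext1 i j
  by_cases h : i = j
  · subst h; simp
  · rw [submatrix_apply, charmatrix_apply_ne _ _ _ h, charmatrix_apply_ne _ _ _
      (fun h' => h (Fin.succAbove_right_injective h')), submatrix_apply]

lemma Matrix.continuous_charpoly_coeff (i : ℕ) :
    Continuous fun W : Matrix ι ι ℝ => W.charpoly.coeff i := by
  have h : (fun W : Matrix ι ι ℝ => W.charpoly.coeff i) = fun W =>
      MvPolynomial.eval (fun p : ι × ι => W p.1 p.2) ((Matrix.charpoly.univ ℝ ι).coeff i) := by
    ext1 W
    exact (Matrix.charpoly.univ_coeff_eval₂Hom ι (RingHom.id ℝ) (fun p : ι × ι => W p.1 p.2) i).symm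
  rw [h]
  exact (MvPolynomial.continuous_eval _).comp (by fun_prop)

/-- A perturbation by one elementary matrix isolates one adjugate entry. Measurability and `L²`
bounds for adjugates thus follow from those for characteristic polynomials of shifted matrices,
which is why a shift `K` is carried along below. -/
lemma Matrix.charAdjugate_coeff_eq (W : Matrix ι ι ℝ) (k l : ι) (i : ℕ) :
    (W.charAdjugate k l).coeff i = W.charpoly.coeff i -
      (W + vecMulVec (Pi.single l 1) (Pi.single k 1)).charpoly.coeff i := by
  rw [charpoly_add_vecMulVec, Fintype.sum_eq_single (k, l)]
  · simp
  · rintro ⟨p, q⟩ h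
    by_cases hp : p = k
    · have : q ≠ l := fun hq => h (by rw [hp, hq])
      simp [this]
    · simp [hp]

end CharacteristicPolynomial

/-! ### Moments of independent variables -/

section Moments

variable {Ω : Type*} [MeasurableSpace Ω] {P : Measure Ω} {Q : Measure ℝ} {n m : ℕ}

lemma integrable_pow_of_integrable_pow_four [IsProbabilityMeasure Q]
    (hQ4 : Integrable (fun x : ℝ => x ^ 4) Q) {c : ℕ} (hc : c ≤ 4) :
    Integrable (fun x : ℝ => x ^ c) Q := by
  refine ((integrable_const (1 : ℝ)).add hQ4).mono' (by fun_prop) (ae_of_all _ fun x => ?_)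
  simp only [Real.norm_eq_abs, abs_pow, Pi.add_apply]
  have h4 : x ^ 4 = |x| ^ 4 := by rw [Even.pow_abs ⟨2, rfl⟩]
  rw [h4]
  rcases le_total |x| 1 with h | h
  · exact (pow_le_one₀ (abs_nonneg x) h).trans (le_add_of_nonneg_right (by positivity))
  · exact (pow_le_pow_right₀ h hc).trans (le_add_of_nonneg_left zero_le_one)

variable {ι : Type*} [Fintype ι]

lemma integral_prod_pow {r : Ω → ι → ℝ} (hlaw : ∀ k, HasLaw (fun ω => r ω k) Q P)
    (hind : iIndepFun (fun k ω => r ω k) P) (c : ι → ℕ) :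
    ∫ ω, ∏ k, r ω k ^ c k ∂P = ∏ k, ∫ x, x ^ c k ∂Q := by
  rw [hind.integral_fun_prod_comp (f := fun k x => x ^ c k) (fun k => (hlaw k).aemeasurable)
    (fun k => by fun_prop)]
  refine Finset.prod_congr rfl fun k _ => ?_
  rw [← (hlaw k).map_eq, integral_map (hlaw k).aemeasurable (by fun_prop)]

lemma integrable_prod_pow [IsProbabilityMeasure Q] {r : Ω → ι → ℝ}
    (hlaw : ∀ k, HasLaw (fun ω => r ω k) Q P)
    (hind : iIndepFun (fun k ω => r ω k) P) (hQ4 : Integrable (fun x : ℝ => x ^ 4) Q)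
    (c : ι → ℕ) (hc : ∀ k, c k ≤ 4) :
    Integrable (fun ω => ∏ k, r ω k ^ c k) P := by
  have hmap : P.map (fun ω k => r ω k) = Measure.pi fun _ => Q := by
    rw [hind.map_fun_eq_pi_map fun k => (hlaw k).aemeasurable]
    simp only [(hlaw _).map_eq]
  have h : Integrable (fun x : ι → ℝ => ∏ k, x k ^ c k) (P.map (fun ω k => r ω k)) := by
    rw [hmap]
    exact Integrable.fintype_prod (f := fun k x => x ^ c k)
      fun k => integrable_pow_of_integrable_pow_four hQ4 (hc k)
  exact h.comp_aemeasurable (aemeasurable_pi_lambda _ fun k => (hlaw k).aemeasurable)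

variable [DecidableEq ι]

lemma prod_pow_ite_eq (r : ι → ℝ) (k : ι) : ∏ i, r i ^ (if i = k then 1 else 0) = r k := by
  simp [pow_ite]

variable [IsProbabilityMeasure Q] {r : Ω → ι → ℝ}

lemma integral_mul_of_hasLaw (hlaw : ∀ k, HasLaw (fun ω => r ω k) Q P)
    (hind : iIndepFun (fun k ω => r ω k) P) (h1 : ∫ x, x ∂Q = 0) (h2 : ∫ x, x ^ 2 ∂Q = 1)
    (k l : ι) : ∫ ω, r ω k * r ω l ∂P = if k = l then 1 else 0 := by
  have h := integral_prod_pow hlaw hind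
    (fun i => (if i = k then 1 else 0) + (if i = l then 1 else 0))
  simp only [pow_add, Finset.prod_mul_distrib, prod_pow_ite_eq] at h
  simp only [← pow_add] at h
  rw [h]
  split_ifs with hkl
  · subst hkl
    refine Finset.prod_eq_one fun i _ => ?_
    by_cases hi : i = k <;> simp [hi, h2]
  · refine Finset.prod_eq_zero (Finset.mem_univ k) ?_
    simp [hkl, h1]

lemma integrable_mul_mul_mul (hlaw : ∀ k, HasLaw (fun ω => r ω k) Q P)
    (hind : iIndepFun (fun k ω => r ω k) P) (hQ4 : Integrable (fun x : ℝ => x ^ 4) Q)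
    (k l p q : ι) : Integrable (fun ω => r ω k * r ω l * (r ω p * r ω q)) P := by
  have h := integrable_prod_pow hlaw hind hQ4
    (fun i => (if i = k then 1 else 0) + (if i = l then 1 else 0) +
      ((if i = p then 1 else 0) + (if i = q then 1 else 0))) (fun i => by split_ifs <;> simp)
  simpa only [pow_add, Finset.prod_mul_distrib, prod_pow_ite_eq] using h

/-- Only the multiplicities of the indices matter: an index of multiplicity one gives `0`,
multiplicities all `0` or `2` give `1`, and four equal indices give `b`, of which the three pairings
account for `3`. -/
lemma integral_mul_mul_mul (hlaw : ∀ k, HasLaw (fun ω => r ω k) Q P)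
    (hind : iIndepFun (fun k ω => r ω k) P) {b : ℝ} (h1 : ∫ x, x ∂Q = 0)
    (h2 : ∫ x, x ^ 2 ∂Q = 1) (h4 : ∫ x, x ^ 4 ∂Q = b) (k l p q : ι) :
    ∫ ω, r ω k * r ω l * (r ω p * r ω q) ∂P =
      (if k = l ∧ p = q then 1 else 0) + (if k = p ∧ l = q then 1 else 0) +
      (if k = q ∧ l = p then 1 else 0) + (b - 3) * (if k = l ∧ k = p ∧ k = q then 1 else 0) := by
  have h := integral_prod_pow hlaw hind
    (fun i => (if i = k then 1 else 0) + (if i = l then 1 else 0) +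
      ((if i = p then 1 else 0) + (if i = q then 1 else 0)))
  simp only [pow_add, Finset.prod_mul_distrib, prod_pow_ite_eq] at h
  simp only [← pow_add] at h
  rw [h]
  clear h
  set c : ι → ℕ := fun i => (if i = k then 1 else 0) + (if i = l then 1 else 0) +
      ((if i = p then 1 else 0) + (if i = q then 1 else 0)) with hc
  change ∏ i, ∫ x, x ^ c i ∂Q = _
  have hzero : ∀ s, c s = 1 → ∏ i, ∫ x, x ^ c i ∂Q = 0 := fun s hs =>
    Finset.prod_eq_zero (Finset.mem_univ s) (by simp [hs, h1])
  have hone : (∀ i, c i = 0 ∨ c i = 2) → ∏ i, ∫ x, x ^ c i ∂Q = 1 := fun hs =>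
    Finset.prod_eq_one fun i _ => by rcases hs i with h | h <;> simp [h, h2]
  by_cases hkl : k = l
  · subst hkl
    by_cases hpq : p = q
    · subst hpq
      by_cases hkp : k = p
      · subst hkp
        have : ∏ i, ∫ x, x ^ c i ∂Q = b := by
          rw [Finset.prod_eq_single k (fun i _ hi => by simp [hc, hi]) (by simp)]
          simp [hc, h4]
        rw [this]; simp; ring
      · rw [hone fun i => ?_]
        · simp [hkp]
        · by_cases hi : i = k
          · subst hi; simp [hc, hkp]
          · by_cases hi' : i = p
            · subst hi'; simp [hc, hi]
            · simp [hc, hi, hi']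
    · by_cases hkp : k = p
      · subst hkp
        rw [hzero q (by simp [hc, Ne.symm hpq])]; simp [hpq]
      · rw [hzero p (by simp [hc, hpq, Ne.symm hkp])]; simp [hpq, hkp]
  · by_cases hkp : k = p
    · subst hkp
      by_cases hlq : l = q
      · subst hlq
        rw [hone fun i => ?_]
        · simp [hkl]
        · by_cases hi : i = k
          · subst hi; simp [hc, hkl]
          · by_cases hi' : i = l
            · subst hi'; simp [hc, hi]
            · simp [hc, hi, hi']
      · rw [hzero l (by simp [hc, hlq, Ne.symm hkl])]; simp [hkl, Ne.symm hkl, hlq]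
    · by_cases hkq : k = q
      · subst hkq
        by_cases hlp : l = p
        · subst hlp
          rw [hone fun i => ?_]
          · simp [hkl]
          · by_cases hi : i = k
            · subst hi; simp [hc, hkl]
            · by_cases hi' : i = l
              · subst hi'; simp [hc, hi]
              · simp [hc, hi, hi']
        · rw [hzero l (by simp [hc, hlp, Ne.symm hkl])]; simp [hkl, hkp, hlp]
      · rw [hzero k (by simp [hc, hkl, hkp, hkq])]; simp [hkl, hkp, hkq]

end Moments

/-! ### Independent identically distributed matrices -/

namespace IsIIDMatrix

variable {Ω : Type*} [MeasurableSpace Ω] {P : Measure Ω} {Q : Measure ℝ} {n m : ℕ}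

lemma submatrix {n' m' : ℕ} {X : Ω → Matrix (Fin n) (Fin m) ℝ} (hX : IsIIDMatrix P Q X)
    {f : Fin n' → Fin n} {g : Fin m' → Fin m} (hf : f.Injective) (hg : g.Injective) :
    IsIIDMatrix P Q (fun ω => (X ω).submatrix f g) where
  hasLaw i j := hX.hasLaw (f i) (g j)
  indep := hX.indep.precomp (g := Prod.map f g) (hf.prodMap hg)

variable {X : Ω → Matrix (Fin (n + 1)) (Fin m) ℝ}

lemma indepFun_row (hX : IsIIDMatrix P Q X) :
    IndepFun (fun ω => X ω 0) (fun ω (i : Fin n) => X ω i.succ) P := by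
  let S : Finset (Fin (n + 1) × Fin m) := Finset.univ.filter fun p => p.1 = 0
  let R : Finset (Fin (n + 1) × Fin m) := Finset.univ.filter fun p => p.1 ≠ 0
  have hSR : Disjoint S R := Finset.disjoint_filter_filter_not _ _ _
  have h := hX.indep.indepFun_finset₀ S R hSR fun p => (hX.hasLaw p.1 p.2).aemeasurable
  have hφ : Measurable fun (v : S → ℝ) (j : Fin m) => v ⟨(0, j), by simp [S]⟩ := by fun_prop
  have hψ : Measurable fun (v : R → ℝ) (i : Fin n) (j : Fin m) =>
      v ⟨(i.succ, j), by simp [R]⟩ := by fun_prop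
  exact h.comp hφ hψ

lemma row (hX : IsIIDMatrix P Q X) : (∀ k, HasLaw (fun ω => X ω 0 k) Q P) ∧
    iIndepFun (fun k ω => X ω 0 k) P :=
  ⟨hX.hasLaw 0, hX.indep.precomp (g := fun k => ((0 : Fin (n + 1)), k))
    fun _ _ h => (Prod.mk.inj h).2⟩

end IsIIDMatrix

lemma transpose_mul_self_eq_add_vecMulVec {n m : ℕ} (X : Matrix (Fin (n + 1)) (Fin m) ℝ) :
    X.transpose * X = (X.submatrix Fin.succ id).transpose * X.submatrix Fin.succ id +
      Matrix.vecMulVec (X 0) (X 0) := by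
  ext i j
  simp [Matrix.mul_apply, Fin.sum_univ_succ, Matrix.vecMulVec_apply, add_comm]

lemma transpose_mul_self_isSymm {n m : ℕ} (X : Matrix (Fin n) (Fin m) ℝ) :
    (X.transpose * X).IsSymm := by
  simp [Matrix.IsSymm, Matrix.transpose_mul]

/-! ### Square integrability of the characteristic coefficients -/

section Integrability

variable {Ω : Type*} [MeasurableSpace Ω] {P : Measure Ω} {Q : Measure ℝ}
  [IsProbabilityMeasure P] [IsProbabilityMeasure Q]

omit [IsProbabilityMeasure P] in
lemma memLp_mul_of_indepFun {f g : Ω → ℝ} (h : IndepFun f g P) (hf : MemLp f 2 P)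
    (hg : MemLp g 2 P) : MemLp (fun ω => f ω * g ω) 2 P := by
  rw [memLp_two_iff_integrable_sq (f := fun ω => f ω * g ω) (hf.1.mul hg.1)]
  have h2 : IndepFun (fun ω => f ω ^ 2) (fun ω => g ω ^ 2) P :=
    h.comp (φ := fun x => x ^ 2) (ψ := fun x => x ^ 2) (by fun_prop) (by fun_prop)
  have h3 : Integrable (fun ω => f ω ^ 2 * g ω ^ 2) P :=
    h2.integrable_mul hf.integrable_sq hg.integrable_sq
  simpa only [mul_pow] using h3

lemma measurable_charpoly_coeff_gram {n m : ℕ} (K : Matrix (Fin m) (Fin m) ℝ) (i : ℕ) :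
    Measurable fun Y : Fin n → Fin m → ℝ =>
      ((Matrix.of Y).transpose * Matrix.of Y + K).charpoly.coeff i := by
  have : Continuous fun Y : Fin n → Fin m → ℝ =>
      ((Matrix.of Y).transpose * Matrix.of Y + K).charpoly.coeff i := by
    refine (Matrix.continuous_charpoly_coeff i).comp ?_
    refine continuous_pi fun k => continuous_pi fun l => ?_
    simp only [Matrix.add_apply, Matrix.mul_apply, Matrix.transpose_apply, Matrix.of_apply]
    fun_prop
  exact this.measurable

lemma measurable_charAdjugate_coeff_gram {n m : ℕ} (K : Matrix (Fin m) (Fin m) ℝ)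
    (p : Fin m × Fin m) (i : ℕ) :
    Measurable fun Y : Fin n → Fin m → ℝ =>
      (((Matrix.of Y).transpose * Matrix.of Y + K).charAdjugate p.1 p.2).coeff i := by
  simp only [Matrix.charAdjugate_coeff_eq, add_assoc]
  exact (measurable_charpoly_coeff_gram _ _).sub (measurable_charpoly_coeff_gram _ _)

omit [IsProbabilityMeasure P] in
lemma memLp_charAdjugate_coeff_of_charpoly {n m : ℕ} {X : Ω → Matrix (Fin n) (Fin m) ℝ} {i : ℕ}
    (h : ∀ K : Matrix (Fin m) (Fin m) ℝ,
      MemLp (fun ω => ((X ω).transpose * X ω + K).charpoly.coeff i) 2 P)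
    (K : Matrix (Fin m) (Fin m) ℝ) (p : Fin m × Fin m) :
    MemLp (fun ω => (((X ω).transpose * X ω + K).charAdjugate p.1 p.2).coeff i) 2 P := by
  simp only [Matrix.charAdjugate_coeff_eq, add_assoc]
  exact (h K).sub (h _)

/-- Induction on the rows. A new row enters through products of two of its entries, multiplied by
independent adjugate entries of the remaining matrix, so finite fourth moments suffice for `L²`. -/
lemma memLp_charpoly_coeff (hQ4 : Integrable (fun x : ℝ => x ^ 4) Q) {m : ℕ} (i : ℕ) (n : ℕ) :
    ∀ (X : Ω → Matrix (Fin n) (Fin m) ℝ), IsIIDMatrix P Q X → ∀ K : Matrix (Fin m) (Fin m) ℝ,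
      MemLp (fun ω => ((X ω).transpose * X ω + K).charpoly.coeff i) 2 P := by
  induction n with
  | zero =>
    intro X _ K
    have : ∀ ω, (X ω).transpose * X ω + K = K := fun ω => by
      ext k l; simp
    simp only [this]
    exact memLp_const _
  | succ n ih =>
    intro X hX K
    have hY := hX.submatrix (Fin.succ_injective n) Function.injective_id
    have hrow := hX.row
    have hdecomp : ∀ ω, ((X ω).transpose * X ω + K) =
        ((X ω).submatrix Fin.succ id).transpose * (X ω).submatrix Fin.succ id + K +
          Matrix.vecMulVec (X ω 0) (X ω 0) := fun ω => by
      rw [transpose_mul_self_eq_add_vecMulVec]; abel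
    simp only [hdecomp, Matrix.charpoly_add_vecMulVec]
    refine (ih _ hY K).sub (memLp_finsetSum _ fun p _ => ?_)
    have hind : IndepFun (fun ω => X ω 0 p.1 * X ω 0 p.2) (fun ω =>
        ((((X ω).submatrix Fin.succ id).transpose * (X ω).submatrix Fin.succ id +
          K).charAdjugate p.1 p.2).coeff i) P :=
      hX.indepFun_row.comp (φ := fun v : Fin m → ℝ => v p.1 * v p.2)
        (ψ := fun Y : Fin n → Fin m → ℝ =>
          (((Matrix.of Y).transpose * Matrix.of Y + K).charAdjugate p.1 p.2).coeff i)
        (by fun_prop) (measurable_charAdjugate_coeff_gram K p i)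
    refine memLp_mul_of_indepFun hind ?_ (memLp_charAdjugate_coeff_of_charpoly (ih _ hY) K p)
    have h1 := (hrow.1 p.1).aemeasurable
    have h2 := (hrow.1 p.2).aemeasurable
    rw [memLp_two_iff_integrable_sq (by fun_prop)]
    simpa only [sq] using integrable_mul_mul_mul hrow.1 hrow.2 hQ4 p.1 p.2 p.1 p.2

end Integrability

/-! ### The row recursion for the correlation coefficients -/

section RowRecursion

open CoeffArray

variable {Ω : Type*} [MeasurableSpace Ω] {P : Measure Ω} {Q : Measure ℝ}
  [IsProbabilityMeasure P] [IsProbabilityMeasure Q]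

/-- The expected products of coefficients of the characteristic polynomial of `XᵀX`. -/
noncomputable def meanCoeff (P : Measure Ω) {n m : ℕ} (X : Ω → Matrix (Fin n) (Fin m) ℝ) :
    CoeffArray := fun i j =>
  ∫ ω, ((X ω).transpose * X ω).charpoly.coeff i * ((X ω).transpose * X ω).charpoly.coeff j ∂P

omit [IsProbabilityMeasure P] in
lemma integral_divDiff_tensor {a : Ω → ℕ → ℝ} (ha : ∀ i j, Integrable (fun ω => a ω i * a ω j) P)
    (i j : ℕ) :
    ∫ ω, divDiff (tensor (a ω) (a ω)) i j ∂P = divDiff (fun i j => ∫ ω, a ω i * a ω j ∂P) i j := by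
  simp only [divDiff_apply, Pi.sub_apply, pd₁_apply, pd₂_apply, tensor]
  rw [integral_neg, integral_finsetSum]
  · congr 1
    refine Finset.sum_congr rfl fun s _ => ?_
    rw [integral_sub ((ha _ _).const_mul _) ((ha _ _).const_mul _), integral_const_mul,
      integral_const_mul]
  · exact fun s _ => ((ha _ _).const_mul _).sub ((ha _ _).const_mul _)

lemma sum_prod_ite_eq {ι : Type*} [Fintype ι] [DecidableEq ι] (f : ι × ι → ℝ) :
    ∑ p : ι × ι, (if p.1 = p.2 then 1 else 0) * f p = ∑ k, f (k, k) := by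
  rw [Fintype.sum_prod_type]
  exact Finset.sum_congr rfl fun k _ => by simp

lemma sum_fourth_moment {ι : Type*} [Fintype ι] [DecidableEq ι] (κ : ℝ) (J : ι × ι → ι × ι → ℝ) :
    ∑ p : ι × ι, ∑ q : ι × ι, ((if p.1 = p.2 ∧ q.1 = q.2 then 1 else 0) +
      (if p.1 = q.1 ∧ p.2 = q.2 then 1 else 0) + (if p.1 = q.2 ∧ p.2 = q.1 then 1 else 0) +
      κ * (if p.1 = p.2 ∧ p.1 = q.1 ∧ p.1 = q.2 then 1 else 0)) * J p q =
    (∑ k, ∑ l, J (k, k) (l, l)) + (∑ p, J p p) + (∑ p, J p p.swap) +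
      κ * ∑ k, J (k, k) (k, k) := by
  simp only [add_mul, Finset.sum_add_distrib]
  congr 1
  · congr 1
    · congr 1
      · simp_rw [ite_and, ite_mul, zero_mul, one_mul]
        rw [Fintype.sum_prod_type]
        refine Finset.sum_congr rfl fun k _ => ?_
        rw [Finset.sum_eq_single k (fun l _ h => by simp [h.symm]) (by simp)]
        simpa using sum_prod_ite_eq (fun q => J (k, k) q)
      · refine Finset.sum_congr rfl fun p _ => ?_
        rw [Finset.sum_eq_single p ?_ (by simp)]
        · simp
        · rintro q - h
          have : ¬ (p.1 = q.1 ∧ p.2 = q.2) := fun h' => h (Prod.ext h'.1.symm h'.2.symm)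
          simp [this]
    · refine Finset.sum_congr rfl fun p _ => ?_
      rw [Finset.sum_eq_single p.swap ?_ (by simp)]
      · simp
      · rintro q - h
        have : ¬ (p.1 = q.2 ∧ p.2 = q.1) := fun h' => h (Prod.ext h'.2.symm h'.1.symm)
        simp [this]
  · rw [Finset.mul_sum, Fintype.sum_prod_type]
    refine Finset.sum_congr rfl fun k _ => ?_
    rw [Finset.sum_eq_single k (fun l _ h => by simp [h.symm]) (by simp),
      Finset.sum_eq_single (k, k) ?_ (by simp)]
    · simp
    · rintro q - h
      have : ¬ (k = q.1 ∧ k = q.2) := fun h' => h (Prod.ext h'.1.symm h'.2.symm)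
      simp [this]

lemma meanCoeff_succ (hQ4 : Integrable (fun x : ℝ => x ^ 4) Q) {b : ℝ} (h1 : ∫ x, x ∂Q = 0)
    (h2 : ∫ x, x ^ 2 ∂Q = 1) (h4 : ∫ x, x ^ 4 ∂Q = b) {n m : ℕ}
    {X : Ω → Matrix (Fin (n + 1)) (Fin m) ℝ} (hX : IsIIDMatrix P Q X) (i j : ℕ) :
    meanCoeff P X i j = gaussStep (meanCoeff P fun ω => (X ω).submatrix Fin.succ id) i j +
      (b - 3) * ∑ k, ∫ ω,
        ((((X ω).submatrix Fin.succ id).transpose *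
          (X ω).submatrix Fin.succ id).charAdjugate k k).coeff i *
        ((((X ω).submatrix Fin.succ id).transpose *
          (X ω).submatrix Fin.succ id).charAdjugate k k).coeff j ∂P := by
  have hY := hX.submatrix (Fin.succ_injective n) Function.injective_id
  set Y : Ω → Matrix (Fin n) (Fin m) ℝ := fun ω => (X ω).submatrix Fin.succ id with hYdef
  have hrow := hX.row
  let W : Ω → Matrix (Fin m) (Fin m) ℝ := fun ω => (Y ω).transpose * Y ω
  let a : Ω → ℕ → ℝ := fun ω => (W ω).charpoly.coeff
  let B : Fin m × Fin m → Ω → ℕ → ℝ := fun p ω => ((W ω).charAdjugate p.1 p.2).coeff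
  -- The index `none` stands for the characteristic polynomial and `some p` for an adjugate entry;
  -- the new coefficient is then a single sum of (function of the row) times (function of the other
  -- rows).
  let H : Option (Fin m × Fin m) → Ω → ℕ → ℝ := fun s => s.elim a B
  let ρ : Option (Fin m × Fin m) → (Fin m → ℝ) → ℝ :=
    fun s v => s.elim 1 fun p => -(v p.1 * v p.2)
  let η : Option (Fin m × Fin m) → ℕ → (Fin n → Fin m → ℝ) → ℝ := fun s i Z =>
    s.elim (((Matrix.of Z).transpose * Matrix.of Z).charpoly.coeff i)
      fun p => (((Matrix.of Z).transpose * Matrix.of Z).charAdjugate p.1 p.2).coeff i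
  have hρ : ∀ s, Measurable (ρ s) := by
    rintro (_ | p)
    · exact measurable_const
    · change Measurable fun v : Fin m → ℝ => -(v p.1 * v p.2)
      fun_prop
  have hη : ∀ s i, Measurable (η s i) := by
    rintro (_ | p) i
    · have h := measurable_charpoly_coeff_gram (n := n) (m := m) 0 i
      simp only [add_zero] at h
      exact h
    · have h := measurable_charAdjugate_coeff_gram (n := n) (m := m) 0 p i
      simp only [add_zero] at h
      exact h
  have hLp : ∀ s i, MemLp (fun ω => H s ω i) 2 P := by
    rintro (_ | p) i
    · have h := memLp_charpoly_coeff hQ4 i n Y hY 0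
      simp only [add_zero] at h
      exact h
    · have h := memLp_charAdjugate_coeff_of_charpoly (memLp_charpoly_coeff hQ4 i n Y hY) 0 p
      simp only [add_zero] at h
      exact h
  have hHint : ∀ s t i j, Integrable (fun ω => H s ω i * H t ω j) P := fun s t i j =>
    (hLp s i).integrable_mul (hLp t j)
  have hcoeff : ∀ ω i, ((X ω).transpose * X ω).charpoly.coeff i = ∑ s, ρ s (X ω 0) * H s ω i := by
    intro ω i
    rw [transpose_mul_self_eq_add_vecMulVec, Matrix.charpoly_add_vecMulVec, Fintype.sum_option,
      sub_eq_add_neg, ← Finset.sum_neg_distrib]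
    simp [ρ, H, a, B, W, hYdef]
  have hρmean : ∀ s t, Integrable (fun ω => ρ s (X ω 0) * ρ t (X ω 0)) P := by
    have hsq : ∀ p : Fin m × Fin m, MemLp (fun ω => ρ (some p) (X ω 0)) 2 P := by
      intro p
      have h1 := (hrow.1 p.1).aemeasurable
      have h2 := (hrow.1 p.2).aemeasurable
      have : MemLp (fun ω => X ω 0 p.1 * X ω 0 p.2) 2 P := by
        rw [memLp_two_iff_integrable_sq (by fun_prop)]
        simpa only [sq] using integrable_mul_mul_mul hrow.1 hrow.2 hQ4 p.1 p.2 p.1 p.2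
      exact this.neg
    have hall : ∀ s, MemLp (fun ω => ρ s (X ω 0)) 2 P := by
      rintro (_ | p)
      · exact memLp_const 1
      · exact hsq p
    exact fun s t => (hall s).integrable_mul (hall t)
  have hindep : ∀ s t i j, IndepFun (fun ω => ρ s (X ω 0) * ρ t (X ω 0))
      (fun ω => H s ω i * H t ω j) P := by
    intro s t i j
    have h := hX.indepFun_row.comp (φ := fun v => ρ s v * ρ t v)
      (ψ := fun Z => η s i Z * η t j Z) ((hρ s).mul (hρ t)) ((hη s i).mul (hη t j))
    refine h.congr (ae_of_all _ fun ω => rfl) (ae_of_all _ fun ω => ?_)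
    rcases s with _ | p <;> rcases t with _ | q <;> rfl
  have hexp : meanCoeff P X i j = ∑ s, ∑ t, (∫ ω, ρ s (X ω 0) * ρ t (X ω 0) ∂P) *
      ∫ ω, H s ω i * H t ω j ∂P := by
    have hterm : ∀ s t, Integrable (fun ω => ρ s (X ω 0) * ρ t (X ω 0) * (H s ω i * H t ω j)) P :=
      fun s t => (hindep s t i j).integrable_mul (hρmean s t) (hHint s t i j)
    have : ∀ ω, ((X ω).transpose * X ω).charpoly.coeff i *
        ((X ω).transpose * X ω).charpoly.coeff j =
        ∑ s, ∑ t, ρ s (X ω 0) * ρ t (X ω 0) * (H s ω i * H t ω j) := by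
      intro ω
      rw [hcoeff, hcoeff, Finset.sum_mul_sum]
      exact Finset.sum_congr rfl fun s _ => Finset.sum_congr rfl fun t _ => by ring
    simp only [meanCoeff, this]
    rw [integral_finsetSum _ fun s _ => integrable_finsetSum _ fun t _ => hterm s t]
    refine Finset.sum_congr rfl fun s _ => ?_
    rw [integral_finsetSum _ fun t _ => hterm s t]
    refine Finset.sum_congr rfl fun t _ => ?_
    exact (hindep s t i j).integral_fun_mul_eq_mul_integral (hρmean s t).1 (hHint s t i j).1
  let J : Fin m × Fin m → Fin m × Fin m → ℝ := fun p q => ∫ ω, B p ω i * B q ω j ∂P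
  have hexp2 : meanCoeff P X i j = (∫ ω, a ω i * a ω j ∂P) - (∑ k, ∫ ω, a ω i * B (k, k) ω j ∂P) -
      (∑ k, ∫ ω, B (k, k) ω i * a ω j ∂P) + ((∑ k, ∑ l, J (k, k) (l, l)) + (∑ p, J p p) +
      (∑ p, J p p.swap) + (b - 3) * ∑ k, J (k, k) (k, k)) := by
    rw [hexp, ← sum_fourth_moment, ← sum_prod_ite_eq (fun p => ∫ ω, a ω i * B p ω j ∂P),
      ← sum_prod_ite_eq (fun p => ∫ ω, B p ω i * a ω j ∂P)]
    simp only [Fintype.sum_option, Finset.sum_add_distrib]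
    have e0 : ∫ ω, ρ none (X ω 0) * ρ none (X ω 0) ∂P = 1 := by simp [ρ]
    have e1 : ∀ p, ∫ ω, ρ none (X ω 0) * ρ (some p) (X ω 0) ∂P =
        -(if p.1 = p.2 then 1 else 0) := by
      intro p
      rw [← integral_mul_of_hasLaw hrow.1 hrow.2 h1 h2 p.1 p.2, ← integral_neg]
      simp [ρ]
    have e2 : ∀ p, ∫ ω, ρ (some p) (X ω 0) * ρ none (X ω 0) ∂P =
        -(if p.1 = p.2 then 1 else 0) := by
      intro p
      rw [← integral_mul_of_hasLaw hrow.1 hrow.2 h1 h2 p.1 p.2, ← integral_neg]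
      simp [ρ]
    have e3 : ∀ p q, ∫ ω, ρ (some p) (X ω 0) * ρ (some q) (X ω 0) ∂P =
        (if p.1 = p.2 ∧ q.1 = q.2 then 1 else 0) +
      (if p.1 = q.1 ∧ p.2 = q.2 then 1 else 0) + (if p.1 = q.2 ∧ p.2 = q.1 then 1 else 0) +
      (b - 3) * (if p.1 = p.2 ∧ p.1 = q.1 ∧ p.1 = q.2 then 1 else 0) := by
      intro p q
      rw [← integral_mul_mul_mul hrow.1 hrow.2 h1 h2 h4 p.1 p.2 q.1 q.2]
      simp [ρ]
    simp only [e0, e1, e2, e3, neg_mul, one_mul, Finset.sum_neg_distrib]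
    change (∫ ω, a ω i * a ω j ∂P) + _ + _ = _
    simp only [J]
    simp only [H, Option.elim]
    ring
  have htr : ∀ ω i, ∑ k, B (k, k) ω i = (i + 1) * a ω (i + 1) := fun ω i =>
    (W ω).sum_charAdjugate_coeff i
  have haa : ∀ i j, Integrable (fun ω => a ω i * a ω j) P := hHint none none
  have haB : ∀ p i j, Integrable (fun ω => a ω i * B p ω j) P := fun p => hHint none (some p)
  have hBa : ∀ p i j, Integrable (fun ω => B p ω i * a ω j) P := fun p => hHint (some p) none
  have hBB : ∀ p q i j, Integrable (fun ω => B p ω i * B q ω j) P := fun p q =>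
    hHint (some p) (some q)
  have f1 : ∑ k, ∫ ω, a ω i * B (k, k) ω j ∂P = (j + 1) * ∫ ω, a ω i * a ω (j + 1) ∂P := by
    rw [← integral_finsetSum _ fun k _ => haB (k, k) i j, ← integral_const_mul]
    refine integral_congr_ae (ae_of_all _ fun ω => ?_)
    change ∑ k, a ω i * B (k, k) ω j = _
    rw [← Finset.mul_sum, htr]; ring
  have f2 : ∑ k, ∫ ω, B (k, k) ω i * a ω j ∂P = (i + 1) * ∫ ω, a ω (i + 1) * a ω j ∂P := by
    rw [← integral_finsetSum _ fun k _ => hBa (k, k) i j, ← integral_const_mul]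
    refine integral_congr_ae (ae_of_all _ fun ω => ?_)
    change ∑ k, B (k, k) ω i * a ω j = _
    rw [← Finset.sum_mul, htr]; ring
  have f3 : ∑ k, ∑ l, J (k, k) (l, l) =
      (i + 1) * ((j + 1) * ∫ ω, a ω (i + 1) * a ω (j + 1) ∂P) := by
    simp only [J]
    simp_rw [← integral_finsetSum _ fun l _ => hBB (_, _) (l, l) i j]
    rw [← integral_finsetSum _ fun k _ => integrable_finsetSum _ fun l _ => hBB (k, k) (l, l) i j,
      ← integral_const_mul, ← integral_const_mul]
    refine integral_congr_ae (ae_of_all _ fun ω => ?_)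
    change ∑ k, ∑ l, B (k, k) ω i * B (l, l) ω j = _
    rw [← Finset.sum_mul_sum, htr, htr]; ring
  have f4 : ∑ p, J p p.swap = -divDiff (fun i j => ∫ ω, a ω i * a ω j ∂P) i j := by
    simp only [J]
    rw [← integral_finsetSum _ fun p _ => hBB p p.swap i j,
      ← integral_divDiff_tensor haa, ← integral_neg]
    refine integral_congr_ae (ae_of_all _ fun ω => ?_)
    exact (W ω).sum_charAdjugate_mul i j
  -- `W` is symmetric, so two of the Wick pairings coincide; this produces the factor `2` in
  -- `gaussStep`.
  have f5 : ∑ p, J p p = ∑ p, J p p.swap := by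
    refine Finset.sum_congr rfl fun p _ => ?_
    have : B p.swap = B p := by
      ext ω i
      exact congrArg (fun q => q.coeff i)
        (Matrix.charAdjugate_symm (transpose_mul_self_isSymm (Y ω)) p.2 p.1)
    simp only [J, this]
  rw [hexp2, f1, f2, f3, f5, f4, gaussStep_eq]
  simp only [Pi.sub_apply, Pi.add_apply, Pi.smul_apply, smul_eq_mul, pd₁_apply, pd₂_apply]
  simp only [meanCoeff]
  change _ = (∫ ω, a ω i * a ω j ∂P) - _ + _ - 2 * divDiff (fun i j => ∫ ω, a ω i * a ω j ∂P) i j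
    + (b - 3) * ∑ k, J (k, k) (k, k)
  ring

lemma meanCoeff_eq (hQ4 : Integrable (fun x : ℝ => x ^ 4) Q) {b : ℝ} (h1 : ∫ x, x ∂Q = 0)
    (h2 : ∫ x, x ^ 2 ∂Q = 1) (h4 : ∫ x, x ^ 4 ∂Q = b) (n : ℕ) :
    ∀ (m : ℕ) (X : Ω → Matrix (Fin n) (Fin m) ℝ), IsIIDMatrix P Q X →
      meanCoeff P X = correlationCoeff (b - 3) n m := by
  induction n with
  | zero =>
    intro m X _
    ext i j
    have : ∀ ω, (X ω).transpose * X ω = 0 := fun ω => by ext k l; simp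
    simp only [meanCoeff, this, Matrix.charpoly_zero, Fintype.card_fin, integral_const,
      Polynomial.coeff_X_pow, correlationCoeff, diagMonomial, tensor, Pi.single_apply]
    simp
  | succ n ih =>
    intro m X hX
    have hY := hX.submatrix (Fin.succ_injective n) Function.injective_id
    ext i j
    rw [meanCoeff_succ hQ4 h1 h2 h4 hX, ih m _ hY, correlationCoeff, Pi.add_apply, Pi.add_apply,
      Pi.smul_apply, Pi.smul_apply, smul_eq_mul, mul_assoc (b - 3)]
    congr 2
    -- With no columns both sides vanish. Otherwise `charAdjugate k k` belongs to the matrix without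
    -- column `k`, again with i.i.d. entries, and all `m + 1` columns contribute equally.
    rcases m with _ | m
    · simp
    · have : ∀ k : Fin (m + 1), ∫ ω,
          ((((X ω).submatrix Fin.succ id).transpose *
            (X ω).submatrix Fin.succ id).charAdjugate k k).coeff i *
          ((((X ω).submatrix Fin.succ id).transpose *
            (X ω).submatrix Fin.succ id).charAdjugate k k).coeff j ∂P =
          correlationCoeff (b - 3) n m i j := by
        intro k
        rw [← ih m _ (hX.submatrix (Fin.succ_injective n) (Fin.succAbove_right_injective (p := k)))]
        simp only [Matrix.charAdjugate_diag]
        rfl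
      simp only [this, Finset.sum_const, Finset.card_univ, Fintype.card_fin, nsmul_eq_mul,
        Nat.add_sub_cancel]

/-! ### From coefficient arrays to the correlation function -/

lemma charProduct_eq_eval {n m : ℕ} (X : Matrix (Fin n) (Fin m) ℝ) (μ ν : ℝ) :
    charProduct X μ ν =
      (X.transpose * X).charpoly.eval μ * (X.transpose * X).charpoly.eval ν := by
  have h : ∀ t : ℝ, (X.transpose * X - t • (1 : Matrix (Fin m) (Fin m) ℝ)).det =
      (-1) ^ m * (X.transpose * X).charpoly.eval t := by
    intro t
    rw [Matrix.eval_charpoly, ← neg_sub, Matrix.det_neg, Fintype.card_fin, Matrix.scalar_apply,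
      Matrix.smul_one_eq_diagonal]
  rw [charProduct, h, h, mul_mul_mul_comm, ← mul_pow]
  simp

lemma charProduct_eq_sum {n m : ℕ} (X : Matrix (Fin n) (Fin m) ℝ) (μ ν : ℝ) :
    charProduct X μ ν = ∑ i ∈ Finset.range (m + 1), ∑ j ∈ Finset.range (m + 1),
      (X.transpose * X).charpoly.coeff i * (X.transpose * X).charpoly.coeff j * (μ ^ i * ν ^ j) := by
  have h : ∀ t : ℝ, (X.transpose * X).charpoly.eval t = ∑ i ∈ Finset.range (m + 1),
      (X.transpose * X).charpoly.coeff i * t ^ i := fun t =>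
    Polynomial.eval_eq_sum_range' (by simp) t
  rw [charProduct_eq_eval, h, h, Finset.sum_mul_sum]
  exact Finset.sum_congr rfl fun i _ => Finset.sum_congr rfl fun j _ => by ring

lemma integrable_charpoly_coeff_mul (hQ4 : Integrable (fun x : ℝ => x ^ 4) Q) {n m : ℕ}
    {X : Ω → Matrix (Fin n) (Fin m) ℝ} (hX : IsIIDMatrix P Q X) (i j : ℕ) :
    Integrable (fun ω => ((X ω).transpose * X ω).charpoly.coeff i *
      ((X ω).transpose * X ω).charpoly.coeff j) P := by
  have h : ∀ i, MemLp (fun ω => ((X ω).transpose * X ω).charpoly.coeff i) 2 P := fun i => by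
    simpa using memLp_charpoly_coeff hQ4 i n X hX 0
  exact (h i).integrable_mul (h j)

lemma integrable_charProduct (hQ4 : Integrable (fun x : ℝ => x ^ 4) Q) {n m : ℕ}
    {X : Ω → Matrix (Fin n) (Fin m) ℝ} (hX : IsIIDMatrix P Q X) (μ ν : ℝ) :
    Integrable (fun ω => charProduct (X ω) μ ν) P := by
  simp only [charProduct_eq_sum]
  exact integrable_finsetSum _ fun i _ => integrable_finsetSum _ fun j _ =>
    (integrable_charpoly_coeff_mul hQ4 hX i j).mul_const _

lemma correlation_eq_sum (hQ4 : Integrable (fun x : ℝ => x ^ 4) Q) {b : ℝ} (h1 : ∫ x, x ∂Q = 0)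
    (h2 : ∫ x, x ^ 2 ∂Q = 1) (h4 : ∫ x, x ^ 4 ∂Q = b) {n m : ℕ}
    {X : Ω → Matrix (Fin n) (Fin m) ℝ} (hX : IsIIDMatrix P Q X) (μ ν : ℝ) :
    correlation P X μ ν = ∑ i ∈ Finset.range (m + 1), ∑ j ∈ Finset.range (m + 1),
      correlationCoeff (b - 3) n m i j * (μ ^ i * ν ^ j) := by
  have hint := integrable_charpoly_coeff_mul hQ4 hX
  simp only [correlation, charProduct_eq_sum, ← meanCoeff_eq hQ4 h1 h2 h4 n m X hX, meanCoeff]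
  rw [integral_finsetSum _ fun i _ => integrable_finsetSum _ fun j _ => (hint i j).mul_const _]
  refine Finset.sum_congr rfl fun i _ => ?_
  rw [integral_finsetSum _ fun j _ => (hint i j).mul_const _]
  exact Finset.sum_congr rfl fun j _ => integral_mul_const _ _

end RowRecursion

/-! ### Generating functions of coefficient arrays -/

namespace CoeffArray

/-- The value at `(x, y)` of the generating function of a coefficient array. -/
noncomputable def genSum (c : CoeffArray) (x y : ℝ) : ℝ :=
  ∑' p : ℕ × ℕ, c p.1 p.2 * (x ^ p.1 * y ^ p.2)

/-- The generating function of `c` converges at `(x, y)` with sum `s`. -/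
def HasGenSum (c : CoeffArray) (x y s : ℝ) : Prop :=
  HasSum (fun p : ℕ × ℕ => c p.1 p.2 * (x ^ p.1 * y ^ p.2)) s

/-- The entries of `c` decay like those of `C * exp (B * (x + y))`. -/
def FactorialBound (C B : ℝ) (c : CoeffArray) : Prop :=
  ∀ i j, |c i j| ≤ C * (B ^ (i + j) / (i + j).factorial)

lemma HasGenSum.mulDiff {c : CoeffArray} {x y s : ℝ} (h : HasGenSum c x y s) :
    HasGenSum (mulDiff c) x y ((x - y) * s) := by
  have h1 : HasGenSum (mulFst c) x y (x * s) := by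
    have hinj : Function.Injective fun p : ℕ × ℕ => (p.1 + 1, p.2) := fun p q h => by
      simpa [Prod.ext_iff] using h
    refine (hinj.hasSum_iff ?_).mp ?_
    · rintro ⟨i, j⟩ hp
      rcases i with _ | i
      · simp [mulFst]
      · exact absurd ⟨(i, j), rfl⟩ hp
    · refine HasSum.congr_fun (HasSum.mul_left x h) fun p => ?_
      simp only [mulFst, Function.comp_apply, pow_succ]; ring
  have h2 : HasGenSum (mulSnd c) x y (y * s) := by
    have hinj : Function.Injective fun p : ℕ × ℕ => (p.1, p.2 + 1) := fun p q h => by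
      simpa [Prod.ext_iff] using h
    refine (hinj.hasSum_iff ?_).mp ?_
    · rintro ⟨i, j⟩ hp
      rcases j with _ | j
      · simp [mulSnd]
      · exact absurd ⟨(i, j), rfl⟩ hp
    · refine HasSum.congr_fun (HasSum.mul_left y h) fun p => ?_
      simp only [mulSnd, Function.comp_apply, pow_succ]; ring
  rw [sub_mul]
  have h3 := HasSum.sub h1 h2
  simpa only [HasGenSum, CoeffArray.mulDiff, Pi.sub_apply, sub_mul] using h3

lemma HasGenSum.sub {c d : CoeffArray} {x y s t : ℝ} (hc : HasGenSum c x y s)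
    (hd : HasGenSum d x y t) : HasGenSum (c - d) x y (s - t) := by
  have := HasSum.sub hc hd
  simpa only [HasGenSum, Pi.sub_apply, sub_mul] using this

lemma HasGenSum.add {c d : CoeffArray} {x y s t : ℝ} (hc : HasGenSum c x y s)
    (hd : HasGenSum d x y t) : HasGenSum (c + d) x y (s + t) := by
  have := HasSum.add hc hd
  simpa only [HasGenSum, Pi.add_apply, add_mul] using this

lemma HasGenSum.smul {c : CoeffArray} {x y s : ℝ} (r : ℝ) (hc : HasGenSum c x y s) :
    HasGenSum (r • c) x y (r * s) := by
  have := HasSum.mul_left r hc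
  simpa only [HasGenSum, Pi.smul_apply, smul_eq_mul, mul_assoc] using this

lemma hasGenSum_tensor {a b : ℕ → ℝ} {x y s t : ℝ} (ha : HasSum (fun i => a i * x ^ i) s)
    (hb : HasSum (fun i => b i * y ^ i) t) : HasGenSum (tensor a b) x y (s * t) := by
  have hs : Summable fun p : ℕ × ℕ => a p.1 * x ^ p.1 * (b p.2 * y ^ p.2) :=
    summable_mul_of_summable_norm ha.summable.norm hb.summable.norm
  have h := ha.mul hb hs
  have e : (fun p : ℕ × ℕ => tensor a b p.1 p.2 * (x ^ p.1 * y ^ p.2)) =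
      fun p => a p.1 * x ^ p.1 * (b p.2 * y ^ p.2) := by
    ext p; simp only [tensor]; ring
  rw [HasGenSum, e]
  exact h

/-- The bound uses `(i + j)!` because `divDiff` mixes entries along antidiagonals. With `d = i + j`,
each difference costs a factor at most `d + 2` per term and there are at most `d + 1` summands; both
are absorbed by `(d + 2)!`. -/
lemma FactorialBound.divDiff {C B : ℝ} (hC : 0 ≤ C) (hB : 0 ≤ B) {c : CoeffArray}
    (h : FactorialBound C B c) : FactorialBound (2 * B ^ 2 * C) B (divDiff c) := by
  intro i j
  rw [divDiff_apply, abs_neg]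
  have hd : ((i + j + 2).factorial : ℝ) = (i + j + 2) * ((i + j + 1) * (i + j).factorial) := by
    rw [Nat.factorial_succ, Nat.factorial_succ]; push_cast; ring
  have hf : (0 : ℝ) < (i + j).factorial := by positivity
  have hterm : ∀ s ∈ Finset.range (i + 1), |(pd₁ c - pd₂ c) s (i + j + 1 - s)| ≤
      2 * C * B ^ (i + j + 2) / ((i + j + 1) * (i + j).factorial) := by
    intro s hs
    have hs' : s ≤ i := Nat.lt_succ_iff.mp (Finset.mem_range.mp hs)
    obtain ⟨t, ht⟩ : ∃ t, i + j + 1 - s = t := ⟨_, rfl⟩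
    have hst : s + t = i + j + 1 := by omega
    have hstR : (s : ℝ) + t = i + j + 1 := by exact_mod_cast hst
    rw [ht]
    have h1 := h (s + 1) t
    have h2 := h s (t + 1)
    rw [show s + 1 + t = i + j + 2 by omega, hd] at h1
    rw [show s + (t + 1) = i + j + 2 by omega, hd] at h2
    have hs0 : (0 : ℝ) ≤ s := Nat.cast_nonneg s
    have ht0 : (0 : ℝ) ≤ t := Nat.cast_nonneg t
    have hi0 : (0 : ℝ) ≤ (i : ℝ) + j := by positivity
    have key : ∀ r z : ℝ, 0 ≤ r → r ≤ i + j + 2 →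
        |z| ≤ C * (B ^ (i + j + 2) / ((i + j + 2) * ((i + j + 1) * (i + j).factorial))) →
        |r * z| ≤ C * B ^ (i + j + 2) / ((i + j + 1) * (i + j).factorial) := by
      intro r z hr hr' hz
      rw [abs_mul, abs_of_nonneg hr]
      refine (mul_le_mul hr' hz (abs_nonneg z) (by linarith)).trans (le_of_eq ?_)
      field_simp
    have k1 := key (s + 1) _ (by linarith) (by linarith) h1
    have k2 := key (t + 1) _ (by linarith) (by linarith) h2
    rw [Pi.sub_apply, Pi.sub_apply, pd₁_apply, pd₂_apply]
    refine (abs_sub _ _).trans ((add_le_add k1 k2).trans (le_of_eq ?_))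
    ring
  refine (Finset.abs_sum_le_sum_abs _ _).trans ((Finset.sum_le_sum hterm).trans ?_)
  rw [Finset.sum_const, Finset.card_range, nsmul_eq_mul]
  push_cast
  have hi0 : (0 : ℝ) ≤ i := Nat.cast_nonneg i
  have hj0 : (0 : ℝ) ≤ j := Nat.cast_nonneg j
  have e : 2 * B ^ 2 * C * (B ^ (i + j) / ((i + j).factorial : ℝ)) =
      (i + j + 1) * (2 * C * B ^ (i + j + 2) / ((i + j + 1) * ((i + j).factorial : ℝ))) := by
    field_simp
    ring
  rw [e]
  exact mul_le_mul_of_nonneg_right (by linarith) (by positivity)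

lemma summable_factorialBound (C B R : ℝ) (hB : 0 ≤ B) (hR : 0 ≤ R) :
    Summable fun p : ℕ × ℕ => C * (B ^ (p.1 + p.2) / (p.1 + p.2).factorial) * R ^ (p.1 + p.2) := by
  have h1 := Real.summable_pow_div_factorial (B * R)
  have h2 := h1.mul_of_nonneg h1 (fun _ => by positivity) (fun _ => by positivity)
  have h3 : Summable fun p : ℕ × ℕ =>
      B ^ (p.1 + p.2) / (p.1 + p.2).factorial * R ^ (p.1 + p.2) := by
    refine Summable.of_nonneg_of_le (fun _ => by positivity) (fun p => ?_) h2
    have hfac : ((p.1.factorial * p.2.factorial : ℕ) : ℝ) ≤ (p.1 + p.2).factorial := by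
      exact_mod_cast Nat.le_of_dvd (Nat.factorial_pos _)
        (Nat.factorial_mul_factorial_dvd_factorial_add _ _)
    push_cast at hfac
    rw [div_mul_div_comm, ← pow_add, mul_pow, div_mul_eq_mul_div]
    exact div_le_div_of_nonneg_left (by positivity) (by positivity) hfac
  simpa only [mul_assoc] using h3.mul_left C

lemma FactorialBound.norm_le {C B R x y : ℝ} {c : CoeffArray} (h : FactorialBound C B c)
    (hx : |x| ≤ R) (hy : |y| ≤ R) (p : ℕ × ℕ) :
    ‖c p.1 p.2 * (x ^ p.1 * y ^ p.2)‖ ≤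
      C * (B ^ (p.1 + p.2) / (p.1 + p.2).factorial) * R ^ (p.1 + p.2) := by
  have hR : 0 ≤ R := (abs_nonneg x).trans hx
  rw [Real.norm_eq_abs, abs_mul, abs_mul, abs_pow, abs_pow, pow_add R]
  refine mul_le_mul (h _ _) ?_ (by positivity) ((abs_nonneg _).trans (h _ _))
  gcongr

lemma FactorialBound.hasGenSum {C B : ℝ} {c : CoeffArray} (hB : 0 ≤ B) (h : FactorialBound C B c)
    (x y : ℝ) : HasGenSum c x y (genSum c x y) := by
  refine (Summable.of_norm_bounded (summable_factorialBound C B (max |x| |y|) hB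
    (by positivity)) fun p => ?_).hasSum
  exact h.norm_le (le_max_left _ _) (le_max_right _ _) p

lemma FactorialBound.continuous_genSum {C B : ℝ} {c : CoeffArray} (hB : 0 ≤ B)
    (h : FactorialBound C B c) : Continuous fun p : ℝ × ℝ => genSum c p.1 p.2 := by
  rw [continuous_iff_continuousAt]
  intro z
  have hz : Metric.ball (0 : ℝ × ℝ) (‖z‖ + 1) ∈ 𝓝 z :=
    Metric.isOpen_ball.mem_nhds (by simp)
  refine ContinuousOn.continuousAt ?_ hz
  refine continuousOn_tsum (fun p => by fun_prop)
    (summable_factorialBound C B (‖z‖ + 1) hB (by positivity)) fun p w hw => ?_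
  rw [mem_ball_zero_iff] at hw
  exact h.norm_le ((norm_fst_le w).trans hw.le) ((norm_snd_le w).trans hw.le) p

/-- Coefficients of the derivative of a power series. -/
def der (a : ℕ → ℝ) (i : ℕ) : ℝ := (i + 1) * a (i + 1)

lemma pd₁_tensor (a b : ℕ → ℝ) : pd₁ (tensor a b) = tensor (der a) b := by
  ext i j; simp only [pd₁_apply, tensor, der]; ring

lemma pd₂_tensor (a b : ℕ → ℝ) : pd₂ (tensor a b) = tensor a (der b) := by
  ext i j; simp only [pd₂_apply, tensor, der]; ring

/-- With `δ = ∂₁ - ∂₂` and `D = divDiff`, `δ(x - y) = (x - y)δ + 2` gives `(x - y)² D²c = δ²c -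
2Dc`; a third factor `x - y` removes the last `D`. -/
lemma mulDiff_mulDiff_mulDiff_divDiff_divDiff (a : ℕ → ℝ) :
    mulDiff (mulDiff (mulDiff (divDiff (divDiff (tensor a a))))) =
      mulDiff (tensor (der (der a)) a - (2 : ℝ) • tensor (der a) (der a) + tensor a (der (der a))) -
        (2 : ℝ) • (tensor (der a) a - tensor a (der a)) := by
  have hc := tensor_isSymm a
  set c := tensor a a with hcdef
  have h1 := pd₁_mulDiff (divDiff c)
  have h2 := pd₂_mulDiff (divDiff c)
  have e := mulDiff_divDiff hc
  have h3 : mulDiff (mulDiff (divDiff (divDiff c))) =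
      pd₁ (pd₁ c - pd₂ c) - pd₂ (pd₁ c - pd₂ c) - (divDiff c - (-divDiff c)) := by
    rw [mulDiff_divDiff hc.divDiff, mulDiff_sub, ← e, h1, h2]; abel
  rw [h3, mulDiff_sub, mulDiff_sub _ (-divDiff c), mulDiff_neg, e, pd₁_sub_pd₂_comm, hcdef]
  simp only [pd₁_tensor, pd₂_tensor, two_smul]
  abel_nf

/-- The generating function of `divDiff (divDiff (a ⊗ a))` off the diagonal. -/
lemma sub_pow_three_mul_genSum {a : ℕ → ℝ} {C B : ℝ} (hC : 0 ≤ C) (hB : 0 ≤ B)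
    (hbd : FactorialBound C B (tensor a a)) {x y f f' f'' g g' g'' : ℝ}
    (hf : HasSum (fun i => a i * x ^ i) f) (hf' : HasSum (fun i => der a i * x ^ i) f')
    (hf'' : HasSum (fun i => der (der a) i * x ^ i) f'')
    (hg : HasSum (fun i => a i * y ^ i) g) (hg' : HasSum (fun i => der a i * y ^ i) g')
    (hg'' : HasSum (fun i => der (der a) i * y ^ i) g'') :
    (x - y) ^ 3 * genSum (divDiff (divDiff (tensor a a))) x y =
      (x - y) * (f'' * g - 2 * (f' * g') + f * g'') - 2 * (f' * g - f * g') := by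
  have h1 := ((hbd.divDiff hC hB).divDiff (by positivity) hB).hasGenSum hB x y
  have h2 := h1.mulDiff.mulDiff.mulDiff
  rw [mulDiff_mulDiff_mulDiff_divDiff_divDiff] at h2
  have h3 := ((((hasGenSum_tensor hf'' hg).sub ((hasGenSum_tensor hf' hg').smul 2)).add
    (hasGenSum_tensor hf hg'')).mulDiff).sub
      (((hasGenSum_tensor hf' hg).sub (hasGenSum_tensor hf hg')).smul 2)
  rw [← HasSum.unique h2 h3]; ring

end CoeffArray

/-! ### The Bessel function of the first kind -/

/-- The coefficients of the entire function `U` with `J_α(√x) = (√x / 2) ^ α * U x`. -/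
noncomputable def besselCoeff (α i : ℕ) : ℝ :=
  (-1) ^ i / (i.factorial * 4 ^ i * (i + α).factorial)

lemma besselFirst_term (α k : ℕ) (s : ℝ) :
    (-1 : ℝ) ^ k / ((k.factorial : ℝ) * ((k + α).factorial : ℝ)) * (s / 2) ^ (2 * k + α) =
      (s / 2) ^ α * (besselCoeff α k * (s ^ 2) ^ k) := by
  rw [besselCoeff, pow_add, pow_mul, div_pow s 2 2]
  norm_num
  rw [div_pow]
  field_simp

lemma hasDerivAt_besselFirst (α : ℕ) (s : ℝ) :
    HasDerivAt (besselFirst α)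
      (∑' k : ℕ, (-1 : ℝ) ^ k / ((k.factorial : ℝ) * ((k + α).factorial : ℝ)) *
        (((2 * k + α : ℕ) : ℝ) * (s / 2) ^ (2 * k + α - 1) * (1 / 2))) s := by
  set ρ : ℝ := |s| + 1 with hρ
  have hρ1 : 1 ≤ ρ := by rw [hρ]; linarith [abs_nonneg s]
  -- This majorises the differentiated terms on `(-ρ, ρ)`: `2k + α ≤ (2 + α) 2^k`, the coefficient
  -- is at most `1/k!`, and `ρ ≥ 1` allows the exponent `2k + α - 1` to be raised to `2k + α`.
  have hu : Summable fun k : ℕ => (2 + α) * ρ ^ α * ((2 * ρ ^ 2) ^ k / k.factorial) :=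
    (Real.summable_pow_div_factorial _).mul_left _
  have hcoeff : ∀ k : ℕ, |(-1 : ℝ) ^ k / ((k.factorial : ℝ) * ((k + α).factorial : ℝ))| ≤
      1 / k.factorial := by
    intro k
    rw [abs_div, abs_pow, abs_neg, abs_one, one_pow, abs_of_pos (by positivity)]
    refine one_div_le_one_div_of_le (by positivity) ?_
    exact le_mul_of_one_le_right (by positivity) (by exact_mod_cast Nat.factorial_pos _)
  refine hasDerivAt_tsum_of_isPreconnected (y₀ := s) (y := s)
    (g' := fun k z => (-1 : ℝ) ^ k / ((k.factorial : ℝ) * ((k + α).factorial : ℝ)) *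
        (((2 * k + α : ℕ) : ℝ) * (z / 2) ^ (2 * k + α - 1) * (1 / 2)))
    (g := fun k z => (-1 : ℝ) ^ k / ((k.factorial : ℝ) * ((k + α).factorial : ℝ)) *
      (z / 2) ^ (2 * k + α)) hu (isOpen_Ioo (a := -ρ) (b := ρ)) isPreconnected_Ioo
    (fun k z _ => ?_) (fun k z hz => ?_) ?_ ?_ ?_
  · exact (((hasDerivAt_id z).div_const 2).pow _).const_mul _
  · have hz' : |z / 2| ≤ ρ := by
      rw [abs_div, abs_two]
      have := abs_lt.mpr hz
      linarith [abs_nonneg z]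
    rw [Real.norm_eq_abs, abs_mul]
    have h1 : |((2 * k + α : ℕ) : ℝ) * (z / 2) ^ (2 * k + α - 1) * (1 / 2)| ≤
        (2 + α) * 2 ^ k * ρ ^ (2 * k + α) := by
      rw [abs_mul, abs_mul, abs_pow, Nat.abs_cast]
      have hk : (k : ℝ) ≤ 2 ^ k := by exact_mod_cast Nat.lt_two_pow_self.le
      have h1k : (1 : ℝ) ≤ 2 ^ k := one_le_pow₀ one_le_two
      have e1 : ((2 * k + α : ℕ) : ℝ) ≤ (2 + α) * 2 ^ k := by
        push_cast
        nlinarith [Nat.cast_nonneg (α := ℝ) α]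
      have e2 : |z / 2| ^ (2 * k + α - 1) ≤ ρ ^ (2 * k + α) :=
        (pow_le_pow_left₀ (abs_nonneg _) hz' _).trans (pow_le_pow_right₀ hρ1 (Nat.sub_le _ _))
      have e3 : |(1 / 2 : ℝ)| ≤ 1 := by norm_num [abs_le]
      calc _ ≤ ((2 * k + α : ℕ) : ℝ) * |z / 2| ^ (2 * k + α - 1) * 1 :=
            mul_le_mul_of_nonneg_left e3 (by positivity)
        _ ≤ _ := by
            rw [mul_one]
            exact mul_le_mul e1 e2 (by positivity) (by positivity)
    refine (mul_le_mul (hcoeff k) h1 (abs_nonneg _) (by positivity)).trans (le_of_eq ?_)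
    rw [mul_pow, ← pow_mul, pow_add]; ring
  · exact ⟨by linarith [neg_abs_le s], by linarith [le_abs_self s]⟩
  · refine Summable.of_norm_bounded (g := fun k : ℕ => ρ ^ α * ((ρ ^ 2) ^ k / k.factorial))
      ((Real.summable_pow_div_factorial _).mul_left _) fun k => ?_
    rw [Real.norm_eq_abs, abs_mul, abs_pow]
    have hs : |s / 2| ≤ ρ := by
      rw [abs_div, abs_two]; linarith [abs_nonneg s]
    refine (mul_le_mul (hcoeff k) (pow_le_pow_left₀ (abs_nonneg _) hs _) (by positivity)
      (by positivity)).trans (le_of_eq ?_)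
    rw [← pow_mul, pow_add]; ring
  · exact ⟨by linarith [neg_abs_le s], by linarith [le_abs_self s]⟩

lemma summable_pow_mul_div_factorial (x : ℝ) :
    Summable fun i : ℕ => (i + 1 : ℝ) * x ^ i / i.factorial := by
  refine Summable.of_norm_bounded (g := fun i : ℕ => (2 * |x|) ^ i / i.factorial)
      (Real.summable_pow_div_factorial _) fun i => ?_
  rw [Real.norm_eq_abs, abs_div, abs_mul, abs_pow, Nat.abs_cast, mul_pow,
    abs_of_nonneg (by positivity : (0 : ℝ) ≤ i + 1)]
  have hk : (i + 1 : ℝ) ≤ 2 ^ i := by exact_mod_cast Nat.lt_two_pow_self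
  gcongr

lemma abs_besselCoeff_le (α i : ℕ) : |besselCoeff α i| ≤ 1 / i.factorial := by
  rw [besselCoeff, abs_div, abs_pow, abs_neg, abs_one, one_pow, abs_of_pos (by positivity),
    mul_assoc]
  refine one_div_le_one_div_of_le (by positivity) ?_
  refine le_mul_of_one_le_right (by positivity) ?_
  exact one_le_mul_of_one_le_of_one_le (one_le_pow₀ (by norm_num))
    (by exact_mod_cast Nat.factorial_pos _)

lemma summable_besselCoeff (α : ℕ) (x : ℝ) : Summable fun i => besselCoeff α i * x ^ i := by
  refine Summable.of_norm_bounded (g := fun i : ℕ => |x| ^ i / i.factorial)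
      (Real.summable_pow_div_factorial _) fun i => ?_
  rw [Real.norm_eq_abs, abs_mul, abs_pow, div_eq_inv_mul, ← one_div]
  exact mul_le_mul_of_nonneg_right (abs_besselCoeff_le α i) (by positivity)

lemma summable_mul_besselCoeff (α : ℕ) (x : ℝ) :
    Summable fun i : ℕ => i * besselCoeff α i * x ^ i := by
  refine Summable.of_norm_bounded (summable_pow_mul_div_factorial |x|) fun i => ?_
  rw [Real.norm_eq_abs, abs_mul, abs_mul, abs_pow, Nat.abs_cast]
  calc (i : ℝ) * |besselCoeff α i| * |x| ^ i ≤ (i + 1) * (1 / i.factorial) * |x| ^ i := by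
        have := abs_besselCoeff_le α i
        gcongr
        linarith
    _ = _ := by ring

lemma besselFirst_sqrt (α : ℕ) {x : ℝ} (hx : 0 ≤ x) :
    besselFirst α √x = (√x / 2) ^ α * ∑' i, besselCoeff α i * x ^ i := by
  rw [besselFirst, ← tsum_mul_left]
  refine tsum_congr fun k => ?_
  rw [besselFirst_term, Real.sq_sqrt hx]

lemma sqrt_mul_deriv_besselFirst_sqrt (α : ℕ) {x : ℝ} (hx : 0 ≤ x) :
    √x * deriv (besselFirst α) √x = (√x / 2) ^ α *
      (α * ∑' i, besselCoeff α i * x ^ i + 2 * ∑' i : ℕ, i * besselCoeff α i * x ^ i) := by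
  rw [(hasDerivAt_besselFirst α √x).deriv, ← tsum_mul_left, ← tsum_mul_left, ← tsum_mul_left,
    ← Summable.tsum_add ((summable_besselCoeff α x).mul_left _)
      ((summable_mul_besselCoeff α x).mul_left _), ← tsum_mul_left]
  refine tsum_congr fun k => ?_
  have h := besselFirst_term α k √x
  rw [Real.sq_sqrt hx] at h
  have h2 : √x * ((-1 : ℝ) ^ k / ((k.factorial : ℝ) * ((k + α).factorial : ℝ)) *
        (((2 * k + α : ℕ) : ℝ) * (√x / 2) ^ (2 * k + α - 1) * (1 / 2))) =
      ((2 * k + α : ℕ) : ℝ) * ((-1 : ℝ) ^ k / ((k.factorial : ℝ) * ((k + α).factorial : ℝ)) *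
        (√x / 2) ^ (2 * k + α)) := by
    rcases Nat.eq_zero_or_pos (2 * k + α) with h0 | h0
    · rw [h0]; simp
    · have : (√x / 2) ^ (2 * k + α) = (√x / 2) ^ (2 * k + α - 1) * (√x / 2) := by
        rw [← pow_succ, Nat.sub_add_cancel h0]
      rw [this]; ring
  rw [h2, h]; push_cast; ring

/-! ### The differentiated Bessel kernel as a power series -/

open CoeffArray

/-- The reciprocal of `(i + α - 2)!`, with the convention that it vanishes for `i + α < 2`. -/
noncomputable def invFactorialShift (α i : ℕ) : ℝ :=
  if i + α < 2 then 0 else ((i + α - 2).factorial : ℝ)⁻¹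

/-- The coefficients of the Bessel-type function of order `α - 2` that generates the kernel. -/
noncomputable def kernelCoeff (α i : ℕ) : ℝ :=
  (-1) ^ i / (i.factorial * 4 ^ i) * invFactorialShift α i

lemma abs_invFactorialShift_le (α i : ℕ) : |invFactorialShift α i| ≤ 1 := by
  rw [invFactorialShift]
  split_ifs
  · simp
  · rw [abs_of_pos (by positivity)]
    exact inv_le_one_of_one_le₀ (by exact_mod_cast Nat.factorial_pos _)

lemma abs_le_of_eq_mul {a w : ℕ → ℝ} (ha : ∀ i, a i = (-1) ^ i / (i.factorial * 4 ^ i) * w i)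
    (hw : ∀ i, |w i| ≤ 1) (i : ℕ) : |a i| ≤ 1 / i.factorial := by
  rw [ha, abs_mul, abs_div, abs_pow, abs_neg, abs_one, one_pow, abs_of_pos (by positivity)]
  refine (mul_le_of_le_one_right (by positivity) (hw i)).trans ?_
  exact one_div_le_one_div_of_le (by positivity)
    (le_mul_of_one_le_right (by positivity) (one_le_pow₀ (by norm_num)))

lemma factorialBound_tensor {a : ℕ → ℝ} (ha : ∀ i, |a i| ≤ 1 / i.factorial) :
    FactorialBound 1 2 (tensor a a) := by
  intro i j
  rw [tensor, abs_mul, one_mul]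
  refine (mul_le_mul (ha i) (ha j) (abs_nonneg _) (by positivity)).trans ?_
  rw [div_mul_div_comm, one_mul, div_le_div_iff₀ (by positivity) (by positivity), one_mul]
  have h := Nat.add_choose_mul_factorial_mul_factorial i j
  have h2 : (i + j).choose j ≤ 2 ^ (i + j) := Nat.choose_le_two_pow _ _
  have h3 : (i + j).factorial ≤ 2 ^ (i + j) * (i.factorial * j.factorial) := by
    rw [← h, mul_assoc]
    exact Nat.mul_le_mul_right _ h2
  exact_mod_cast h3

lemma factorialBound_kernelCoeff (α : ℕ) :
    FactorialBound 1 2 (tensor (kernelCoeff α) (kernelCoeff α)) :=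
  factorialBound_tensor (abs_le_of_eq_mul (fun _ => rfl) (abs_invFactorialShift_le α))

/-- The reciprocal factorial of `i + α - 1` equals `(i + α)/(i + α)!`, both being `0` under the
convention when `i + α = 0`; thus `α = 0` and `α = 1` need no separate treatment. -/
lemma der_kernelCoeff (α i : ℕ) :
    der (kernelCoeff α) i = -(1 / 4) * ((i + α) * besselCoeff α i) := by
  have h : invFactorialShift α (i + 1) = (i + α) * ((i + α).factorial : ℝ)⁻¹ := by
    rw [invFactorialShift]
    rcases Nat.eq_zero_or_pos (i + α) with h0 | h0
    · have h0' : (i : ℝ) + α = 0 := by exact_mod_cast h0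
      rw [if_pos (by omega), h0']; simp
    · rw [if_neg (by omega)]
      obtain ⟨k, hk⟩ : ∃ k, i + α = k + 1 := ⟨i + α - 1, by omega⟩
      have h0' : (i : ℝ) + α = k + 1 := by exact_mod_cast hk
      rw [h0', hk, show i + 1 + α - 2 = k by omega, Nat.factorial_succ]
      push_cast
      field_simp
  rw [der, kernelCoeff, h, besselCoeff, Nat.factorial_succ]
  push_cast
  field_simp
  ring

lemma der_der_kernelCoeff (α i : ℕ) :
    der (der (kernelCoeff α)) i = 1 / 16 * besselCoeff α i := by
  rw [der, der_kernelCoeff, besselCoeff, besselCoeff, Nat.factorial_succ,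
    show i + 1 + α = i + α + 1 by ring, Nat.factorial_succ]
  push_cast
  have : (i : ℝ) + 1 + α ≠ 0 := by positivity
  have : (i : ℝ) + α + 1 ≠ 0 := by positivity
  field_simp
  ring

/-- The Bessel equation `f = -4 (x f'' + (α - 1) f')` on coefficients. It allows `f` to be expressed
through functions of order `α`. -/
lemma kernelCoeff_eq (α i : ℕ) : kernelCoeff α i = -4 * ((i + (α - 1)) * der (kernelCoeff α) i) := by
  have h : invFactorialShift α i = (i + (α - 1)) * invFactorialShift α (i + 1) := by
    rw [invFactorialShift, invFactorialShift]
    rcases Nat.lt_or_ge (i + α) 2 with h0 | h0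
    · rw [if_pos h0]
      rcases Nat.eq_zero_or_pos (i + α) with h1 | h1
      · rw [if_pos (by omega)]; simp
      · have h0' : (i : ℝ) + α = 1 := by exact_mod_cast (by omega : i + α = 1)
        have : (i : ℝ) + (α - 1) = 0 := by linarith
        rw [this, zero_mul]
    · rw [if_neg (by omega), if_neg (by omega)]
      obtain ⟨k, hk⟩ : ∃ k, i + α = k + 2 := ⟨i + α - 2, by omega⟩
      have h0' : (i : ℝ) + α = k + 2 := by exact_mod_cast hk
      rw [show i + α - 2 = k by omega, show i + 1 + α - 2 = k + 1 by omega, Nat.factorial_succ,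
        show (i : ℝ) + (α - 1) = k + 1 by linarith]
      push_cast
      field_simp
  rw [der, kernelCoeff, kernelCoeff, h, Nat.factorial_succ]
  push_cast
  field_simp
  ring

lemma hasSum_kernelCoeff (α : ℕ) (x : ℝ) :
    let U := ∑' i, besselCoeff α i * x ^ i
    let V := ∑' i : ℕ, i * besselCoeff α i * x ^ i
    HasSum (fun i => kernelCoeff α i * x ^ i) (-(1 / 4) * (x * U) + (α - 1) * (V + α * U)) ∧
    HasSum (fun i => der (kernelCoeff α) i * x ^ i) (-(1 / 4) * (V + α * U)) ∧
    HasSum (fun i => der (der (kernelCoeff α)) i * x ^ i) (1 / 16 * U) := by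
  intro U V
  have hU : HasSum (fun i => besselCoeff α i * x ^ i) U := (summable_besselCoeff α x).hasSum
  have hV : HasSum (fun i : ℕ => i * besselCoeff α i * x ^ i) V :=
    (summable_mul_besselCoeff α x).hasSum
  have h2 : HasSum (fun i => der (der (kernelCoeff α)) i * x ^ i) (1 / 16 * U) := by
    simpa only [der_der_kernelCoeff, mul_assoc] using hU.mul_left (1 / 16)
  have h1 : HasSum (fun i => der (kernelCoeff α) i * x ^ i) (-(1 / 4) * (V + α * U)) := by
    refine HasSum.congr_fun ((hV.add (hU.mul_left (α : ℝ))).mul_left (-(1 / 4) : ℝ)) fun i => ?_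
    rw [der_kernelCoeff]; ring
  have h3 : HasSum (fun i : ℕ => i * der (kernelCoeff α) i * x ^ i) (x * (1 / 16 * U)) := by
    rw [← hasSum_nat_add_iff' 1]
    simp only [Finset.range_one, Finset.sum_singleton, Nat.cast_zero, zero_mul, sub_zero]
    refine HasSum.congr_fun (h2.mul_left x) fun i => ?_
    rw [show der (der (kernelCoeff α)) i = (i + 1) * der (kernelCoeff α) (i + 1) from rfl]
    push_cast; ring
  refine ⟨?_, h1, h2⟩
  rw [show -(1 / 4) * (x * U) + (α - 1) * (V + α * U) =
    -4 * (x * (1 / 16 * U) + (α - 1) * (-(1 / 4) * (V + α * U))) by ring]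
  refine HasSum.congr_fun ((h3.add (h1.mul_left (α - 1 : ℝ))).mul_left (-4 : ℝ)) fun i => ?_
  rw [kernelCoeff_eq]; ring

/-- The power series expression of the differentiated Bessel kernel. -/
noncomputable def kernelSeries (α : ℕ) (x y : ℝ) : ℝ :=
  16 * (x * y / 16) ^ ((α : ℝ) / 2) *
    genSum (divDiff (divDiff (tensor (kernelCoeff α) (kernelCoeff α)))) x y

lemma continuous_kernelSeries (α : ℕ) : Continuous fun p : ℝ × ℝ => kernelSeries α p.1 p.2 := by
  have h := (((factorialBound_kernelCoeff α).divDiff zero_le_one zero_le_two).divDiff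
    (by positivity) zero_le_two).continuous_genSum zero_le_two
  refine Continuous.mul (continuous_const.mul ?_) h
  exact Continuous.rpow_const (by fun_prop) fun _ => Or.inr (by positivity)

/-- Both sides become the same rational expression in `U` and `V = x U'`, where `J_α(√x) = (√x/2)^α
U(x)`: the series side by the Bessel equation, the kernel side by the chain rule. -/
lemma diffBesselFormula_eq {α : ℕ} {x y : ℝ} (hx : 0 ≤ x) (hy : 0 ≤ y) (hxy : x ≠ y) :
    diffBesselFormula α x y = kernelSeries α x y := by
  have hne : x - y ≠ 0 := sub_ne_zero.mpr hxy
  obtain ⟨hf, hf', hf''⟩ := hasSum_kernelCoeff α x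
  obtain ⟨hg, hg', hg''⟩ := hasSum_kernelCoeff α y
  have key := sub_pow_three_mul_genSum zero_le_one zero_le_two (factorialBound_kernelCoeff α)
    hf hf' hf'' hg hg' hg''
  have hpow : (x * y / 16) ^ ((α : ℝ) / 2) = (√x / 2) ^ α * (√y / 2) ^ α := by
    rw [Real.rpow_div_two_eq_sqrt _ (by positivity), Real.rpow_natCast, ← mul_pow,
      Real.sqrt_div' _ (by norm_num), Real.sqrt_mul hx,
      show √(16 : ℝ) = 4 by rw [show (16 : ℝ) = 4 ^ 2 by norm_num]; simp]
    congr 1; ring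
  have hJx := besselFirst_sqrt α hx
  have hJy := besselFirst_sqrt α hy
  have hDx := sqrt_mul_deriv_besselFirst_sqrt α hx
  have hDy := sqrt_mul_deriv_besselFirst_sqrt α hy
  -- Derivatives of the Bessel function occur only as `√x J_α'(√x)`, so no division by `√x` is
  -- needed and the boundary points `x = 0`, `y = 0` are included.
  have hform : diffBesselFormula α x y =
      (x + y) * (besselFirst α √x * (√y * deriv (besselFirst α) √y)
        - (√x * deriv (besselFirst α) √x) * besselFirst α √y) / (2 * (x - y) ^ 3)
      - ((x + y - 2 * (α : ℝ) ^ 2) * besselFirst α √x * besselFirst α √y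
        + 2 * (√x * deriv (besselFirst α) √x) * (√y * deriv (besselFirst α) √y)) /
          (4 * (x - y) ^ 2) := by
    rw [diffBesselFormula, Real.sqrt_mul hx]; ring
  rw [hform, hDx, hDy, hJx, hJy, kernelSeries, hpow, eq_comm,
    eq_div_of_mul_eq (pow_ne_zero 3 hne) ((mul_comm _ _).trans key)]
  field_simp
  ring

lemma diffBesselKernel_eq {α : ℕ} {x y : ℝ} (hx : 0 ≤ x) (hy : 0 ≤ y) :
    diffBesselKernel α x y = kernelSeries α x y := by
  rw [diffBesselKernel]
  split_ifs with h
  · subst h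
    set S : Set (ℝ × ℝ) := {p : ℝ × ℝ | 0 ≤ p.1 ∧ 0 ≤ p.2 ∧ p.1 ≠ p.2} with hS
    -- This sequence shows that the punctured filter is nontrivial, so `limUnder` is the actual
    -- limit.
    have hseq : Tendsto (fun n : ℕ => (x, x + 1 / ((n : ℝ) + 1))) atTop (𝓝[S] (x, x)) := by
      refine tendsto_nhdsWithin_iff.mpr ⟨?_, Eventually.of_forall fun n => ?_⟩
      · refine tendsto_const_nhds.prodMk_nhds ?_
        simpa using tendsto_const_nhds.add (tendsto_one_div_add_atTop_nhds_zero_nat (𝕜 := ℝ))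
      · have : (0 : ℝ) < 1 / ((n : ℝ) + 1) := by positivity
        refine ⟨hx, by positivity, ?_⟩
        change x ≠ x + 1 / ((n : ℝ) + 1)
        linarith
    have : (𝓝[S] (x, x)).NeBot := hseq.neBot
    refine Tendsto.limUnder_eq ?_
    have hcont : Tendsto (fun p : ℝ × ℝ => kernelSeries α p.1 p.2) (𝓝[S] (x, x))
        (𝓝 (kernelSeries α x x)) :=
      ((continuous_kernelSeries α).tendsto (x, x)).mono_left nhdsWithin_le_nhds
    refine hcont.congr' ?_
    filter_upwards [self_mem_nhdsWithin] with p hp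
    exact (diffBesselFormula_eq hp.1 hp.2.1 hp.2.2).symm
  · exact diffBesselFormula_eq hx hy h

/-! ### The rescaled correlation function as a series -/

namespace CoeffArray

/-- The array of the generating function rescaled by `t` in both variables. -/
def scale (t : ℝ) (c : CoeffArray) : CoeffArray := fun i j => t ^ (i + j) * c i j

lemma divDiff_scale (t : ℝ) (c : CoeffArray) :
    divDiff (scale t c) = t ^ 2 • scale t (divDiff c) := by
  ext i j
  simp only [Pi.smul_apply, smul_eq_mul, scale, divDiff_apply, mul_neg, Finset.mul_sum]
  congr 1
  refine Finset.sum_congr rfl fun s hs => ?_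
  have hs' : s ≤ i := Nat.lt_succ_iff.mp (Finset.mem_range.mp hs)
  obtain ⟨r, hr⟩ : ∃ r, i + j + 1 - s = r := ⟨_, rfl⟩
  have e1 : s + 1 + r = i + j + 2 := by omega
  have e2 : s + (r + 1) = i + j + 2 := by omega
  simp only [hr, Pi.sub_apply, pd₁_apply, pd₂_apply]
  simp only [scale, e1, e2, pow_add]
  ring

lemma scale_tensor (t : ℝ) (a : ℕ → ℝ) :
    scale t (tensor a a) = tensor (fun i => a i * t ^ i) (fun i => a i * t ^ i) := by
  ext i j
  simp only [scale, tensor, pow_add]; ring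

lemma scale_smul (t r : ℝ) (c : CoeffArray) : scale t (r • c) = r • scale t c := by
  ext i j
  simp only [scale, Pi.smul_apply, smul_eq_mul]; ring

lemma genSum_scale (t : ℝ) (c : CoeffArray) (x y : ℝ) :
    genSum (scale t c) x y = genSum c (x * t) (y * t) := by
  refine tsum_congr fun p => ?_
  simp only [scale, mul_pow, pow_add]; ring

lemma tensor_smul (r : ℝ) (a : ℕ → ℝ) :
    tensor (fun i => r * a i) (fun i => r * a i) = r ^ 2 • tensor a a := by
  ext i j
  simp only [tensor, Pi.smul_apply, smul_eq_mul]; ring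

lemma hasGenSum_finsetSum {ι : Type*} (s : Finset ι) {c : ι → CoeffArray} {x y : ℝ} {v : ι → ℝ}
    (h : ∀ k ∈ s, HasGenSum (c k) x y (v k)) :
    HasGenSum (∑ k ∈ s, c k) x y (∑ k ∈ s, v k) := by
  have := hasSum_sum h
  simpa only [HasGenSum, Finset.sum_apply, Finset.sum_mul] using this

lemma tendsto_divDiff {c : ℕ → CoeffArray} {d : CoeffArray}
    (h : ∀ i j, Tendsto (fun N => c N i j) atTop (𝓝 (d i j))) (i j : ℕ) :
    Tendsto (fun N => divDiff (c N) i j) atTop (𝓝 (divDiff d i j)) := by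
  simp only [divDiff_apply, Pi.sub_apply, pd₁_apply, pd₂_apply]
  exact (tendsto_finsetSum _ fun s _ => ((h _ _).const_mul _).sub ((h _ _).const_mul _)).neg

lemma tendsto_genSum {C B : ℝ} (hB : 0 ≤ B) {c : ℕ → CoeffArray} {d : CoeffArray}
    (hc : ∀ᶠ N in atTop, FactorialBound C B (c N))
    (h : ∀ i j, Tendsto (fun N => c N i j) atTop (𝓝 (d i j))) (x y : ℝ) :
    Tendsto (fun N => genSum (c N) x y) atTop (𝓝 (genSum d x y)) := by
  refine tendsto_tsum_of_dominated_convergence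
    (summable_factorialBound C B (max |x| |y|) hB (by positivity)) (fun p => ?_) ?_
  · exact (h _ _).mul_const _
  · filter_upwards [hc] with N hN p
    exact hN.norm_le (le_max_left _ _) (le_max_right _ _) p

lemma FactorialBound.abs_genSum_le {C B : ℝ} (hB : 0 ≤ B) {c : CoeffArray}
    (hc : FactorialBound C B c) (x y : ℝ) :
    |genSum c x y| ≤ ∑' p : ℕ × ℕ,
      C * (B ^ (p.1 + p.2) / (p.1 + p.2).factorial) * max |x| |y| ^ (p.1 + p.2) :=
  tsum_of_norm_bounded (summable_factorialBound C B _ hB (by positivity)).hasSum fun p =>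
    hc.norm_le (le_max_left _ _) (le_max_right _ _) p

end CoeffArray

/-- The quotient `(n choose (i + α - 2)) / N ^ (i + α - 2)`, with the convention that it vanishes
for `i + α < 2`. -/
noncomputable def scaledChoose (α N n i : ℕ) : ℝ :=
  if i + α < 2 then 0 else (n.choose (i + α - 2) : ℝ) / (N : ℝ) ^ (i + α - 2)

/-- The rescaled Laguerre coefficients. -/
noncomputable def scaledCoeff (α N n i : ℕ) : ℝ :=
  (-1) ^ i / (i.factorial * 4 ^ i) * scaledChoose α N n i

/-- Binomial symmetry turns `m + 2 - i` into `i + α - 2`, which does not grow with `m`. The common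
power is written `N^α / N^2` since `α - 2` may be negative. -/
lemma laguerreCoeff_mul_pow (α m i : ℕ) {N : ℕ} (hN : 0 < N) :
    laguerreCoeff (m + α) (m + 2) i * ((4 * (N : ℝ))⁻¹) ^ i =
      (-1) ^ m * (m + 2).factorial * (N : ℝ) ^ α / (N : ℝ) ^ 2 * scaledCoeff α N (m + α) i := by
  have hN' : (N : ℝ) ≠ 0 := by positivity
  rw [laguerreCoeff, scaledCoeff, scaledChoose]
  split_ifs with h1 h2 h2
  · rw [Nat.choose_eq_zero_of_lt (by omega)]; simp
  · obtain ⟨p, hp⟩ : ∃ p, i + α = p + 2 := ⟨i + α - 2, by omega⟩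
    have hpow : (N : ℝ) ^ i * (N : ℝ) ^ α = (N : ℝ) ^ p * (N : ℝ) ^ 2 := by
      rw [← pow_add, ← pow_add, hp]
    have hsign : (-1 : ℝ) ^ (m + 2 - i) = (-1) ^ m * (-1) ^ i := by
      have h : (-1 : ℝ) ^ (m + 2 - i) * (-1) ^ i * (-1) ^ i = (-1) ^ m * (-1) ^ i := by
        rw [← pow_add, Nat.sub_add_cancel h1, pow_add]; norm_num
      rw [← h, mul_assoc, ← mul_pow]; norm_num
    have hch : (m + α).choose (m + 2 - i) = (m + α).choose p :=
      Nat.choose_symm_of_eq_add (by omega)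
    rw [hch, hsign, show i + α - 2 = p by omega, inv_pow, mul_pow]
    field_simp
    linear_combination ((m + α).choose p : ℝ) * (-hpow)
  · simp
  · rw [Nat.choose_eq_zero_of_lt (by omega)]; simp

lemma abs_scaledChoose_le (α i : ℕ) {N n : ℕ} (hn : n ≤ N) : |scaledChoose α N n i| ≤ 1 := by
  rw [scaledChoose]
  split_ifs
  · simp
  · rw [abs_of_nonneg (by positivity)]
    refine div_le_one_of_le₀ ?_ (by positivity)
    exact_mod_cast (Nat.choose_le_pow _ _).trans (Nat.pow_le_pow_left hn _)

lemma factorialBound_scaledCoeff (α : ℕ) {N n : ℕ} (hn : n ≤ N) :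
    FactorialBound (2 * 2 ^ 2 * (2 * 2 ^ 2 * 1)) 2
      (divDiff (divDiff (tensor (scaledCoeff α N n) (scaledCoeff α N n)))) :=
  ((factorialBound_tensor (abs_le_of_eq_mul (fun _ => rfl)
    fun i => abs_scaledChoose_le α i hn)).divDiff zero_le_one zero_le_two).divDiff
      (by positivity) zero_le_two

/-- The contribution of the Gaussian correlation function of an `(m + α) × m` matrix. -/
noncomputable def gaussTerm (α N m : ℕ) (x y : ℝ) : ℝ :=
  genSum (divDiff (divDiff (tensor (scaledCoeff α N (m + α)) (scaledCoeff α N (m + α))))) x y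

lemma hasGenSum_scale_gaussStep_pow (α m : ℕ) {N : ℕ} (hN : m + α ≤ N) (hN0 : 0 < N) (x y : ℝ) :
    HasGenSum (scale (4 * (N : ℝ))⁻¹ ((gaussStep ^ (m + α)) (diagMonomial m))) x y
      (256 * (N : ℝ) ^ (2 * α) * (m + 2).factorial * m.factorial * gaussTerm α N m x y) := by
  have hN' : (N : ℝ) ≠ 0 := by positivity
  set t : ℝ := (4 * (N : ℝ))⁻¹ with ht
  set K : ℝ := (-1) ^ m * (m + 2).factorial * (N : ℝ) ^ α / (N : ℝ) ^ 2 with hK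
  set ℓ := laguerreCoeff (m + α) (m + 2) with hℓ
  set σ := scaledCoeff α N (m + α) with hσ
  have ht0 : t ≠ 0 := by rw [ht]; positivity
  have h1 : scale t (tensor ℓ ℓ) = K ^ 2 • tensor σ σ := by
    rw [scale_tensor, ← tensor_smul]
    congr 1 <;> · funext i; exact laguerreCoeff_mul_pow α m i hN0
  -- `divDiff` is homogeneous of degree `-2`, so two applications cost `t^4`; this is the origin of
  -- the factor `256 = 4^4`.
  have h2 : t ^ 4 • scale t (divDiff (divDiff (tensor ℓ ℓ))) =
      K ^ 2 • divDiff (divDiff (tensor σ σ)) := by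
    rw [← map_smul, ← map_smul, ← h1, divDiff_scale, map_smul, divDiff_scale, smul_smul]
    congr 1; ring
  have h3 : scale t ((gaussStep ^ (m + α)) (diagMonomial m)) =
      (((m + 1) * (m + 2) : ℝ)⁻¹ * (t ^ 4)⁻¹ * K ^ 2) • divDiff (divDiff (tensor σ σ)) := by
    rw [gaussStep_pow_diagMonomial, scale_smul, mul_smul, ← h2, smul_smul, mul_assoc,
      inv_mul_cancel₀ (pow_ne_zero 4 ht0), mul_one]
  rw [h3]
  have h4 := ((factorialBound_scaledCoeff α hN).hasGenSum zero_le_two x y).smul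
    (((m + 1) * (m + 2) : ℝ)⁻¹ * (t ^ 4)⁻¹ * K ^ 2)
  refine (congrArg (HasGenSum _ x y) ?_).mp h4
  rw [gaussTerm]
  congr 1
  have hsq : ((-1 : ℝ) ^ m) ^ 2 = 1 := by rw [← pow_mul, mul_comm, pow_mul]; norm_num
  have hf : ((m + 2).factorial : ℝ) = (m + 2) * ((m + 1) * m.factorial) := by
    rw [Nat.factorial_succ, Nat.factorial_succ]; push_cast; ring
  have h1m : (m + 1 : ℝ) ≠ 0 := by positivity
  have h2m : (m + 2 : ℝ) ≠ 0 := by positivity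
  rw [hK, ht, hf, div_pow, mul_pow, mul_pow, hsq, pow_mul' _ 2 α]
  field_simp
  ring

/-- The `k`-th term of the expansion in powers of the fourth cumulant. -/
noncomputable def cumulantTerm (α : ℕ) (κ x y : ℝ) (N k : ℕ) : ℝ :=
  if k + α ≤ N then κ ^ k / k.factorial *
    ((N : ℝ) ^ α * (N - k - α + 2).factorial / ((N : ℝ) ^ 2 * (N - k).factorial)) *
      gaussTerm α N (N - k - α) x y
  else 0

lemma genSum_correlationCoeff (α : ℕ) (κ x y : ℝ) {N : ℕ} (hN : α ≤ N) (hN0 : 0 < N) :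
    genSum (correlationCoeff κ N (N - α)) (x * (4 * (N : ℝ))⁻¹) (y * (4 * (N : ℝ))⁻¹) =
      256 * (N : ℝ) ^ α * (N : ℝ) ^ 2 * N.factorial * (N - α).factorial *
        ∑' k, cumulantTerm α κ x y N k := by
  have hN' : (N : ℝ) ≠ 0 := by positivity
  rw [tsum_eq_sum (s := Finset.range (N + 1)) fun k hk => by
    rw [cumulantTerm, if_neg]
    rw [Finset.mem_range] at hk
    omega]
  rw [← genSum_scale, Finset.mul_sum]
  refine HasSum.tsum_eq ?_
  have hsum : scale (4 * (N : ℝ))⁻¹ (correlationCoeff κ N (N - α)) =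
      ∑ k ∈ Finset.range (N + 1), (N.choose k * (N - α).descFactorial k * κ ^ k : ℝ) •
        scale (4 * (N : ℝ))⁻¹ ((gaussStep ^ (N - k)) (diagMonomial (N - α - k))) := by
    rw [correlationCoeff_eq]
    ext i j
    simp only [scale, Finset.sum_apply, Pi.smul_apply, smul_eq_mul, Finset.mul_sum]
    exact Finset.sum_congr rfl fun k _ => by ring
  rw [hsum]
  refine hasGenSum_finsetSum _ fun k hk => ?_
  by_cases hkN : k + α ≤ N
  · obtain ⟨m, rfl⟩ : ∃ m, N = m + α + k := ⟨N - (k + α), by omega⟩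
    have e1 : m + α + k - k = m + α := by omega
    have e2 : m + α + k - α - k = m := by omega
    have e3 : m + α + k - α = m + k := by omega
    have h := (hasGenSum_scale_gaussStep_pow α m (N := m + α + k) (by omega) hN0 x y).smul
      ((m + α + k).choose k * (m + k).descFactorial k * κ ^ k : ℝ)
    rw [cumulantTerm, if_pos hkN, e1, e2, e3, Nat.add_sub_cancel]
    refine (congrArg (HasGenSum _ x y) ?_).mp h
    have hc : ((m + α + k).choose k : ℝ) * (k.factorial * (m + α).factorial) =
        (m + α + k).factorial := by
      have := Nat.choose_mul_factorial_mul_factorial (n := m + α + k) (k := k) (by omega)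
      rw [e1] at this
      rw [← mul_assoc]
      exact_mod_cast this
    have hd : (m.factorial : ℝ) * (m + k).descFactorial k = (m + k).factorial := by
      have := Nat.factorial_mul_descFactorial (n := m + k) (k := k) (by omega)
      rw [Nat.add_sub_cancel] at this
      exact_mod_cast this
    rw [← hc, ← hd, two_mul, pow_add]
    field_simp
  -- For `k > N - α` there are too few columns to delete, so the falling factorial vanishes.
  · have : (N - α).descFactorial k = 0 := Nat.descFactorial_of_lt (by omega)
    rw [cumulantTerm, if_neg hkN, this]
    simp [HasGenSum, hasSum_zero]

/-! ### Asymptotics -/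

lemma tendsto_natCast_sub_add_div (a : ℕ) (c : ℝ) :
    Tendsto (fun N : ℕ => (((N - a : ℕ) : ℝ) + c) / N) atTop (𝓝 1) := by
  have h : Tendsto (fun N : ℕ => 1 + (c - a) / (N : ℝ)) atTop (𝓝 (1 + 0)) :=
    tendsto_const_nhds.add (tendsto_const_div_atTop_nhds_zero_nat (c - a))
  rw [add_zero] at h
  refine h.congr' ?_
  filter_upwards [eventually_ge_atTop (a + 1)] with N hN
  have hN' : (N : ℝ) ≠ 0 := by
    have : N ≠ 0 := by omega
    exact_mod_cast this
  rw [Nat.cast_sub (by omega)]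
  field_simp
  ring

lemma tendsto_scaledCoeff (α k i : ℕ) :
    Tendsto (fun N : ℕ => scaledCoeff α N (N - k) i) atTop (𝓝 (kernelCoeff α i)) := by
  refine Tendsto.const_mul _ ?_
  simp only [scaledChoose, invFactorialShift]
  split_ifs with h
  · exact tendsto_const_nhds
  · set p := i + α - 2
    have h1 : Tendsto (fun N : ℕ => ∏ s ∈ Finset.range p, (((N - (k + s) : ℕ) : ℝ) + 0) / N)
        atTop (𝓝 (∏ s ∈ Finset.range p, 1)) :=
      tendsto_finsetProd _ fun s _ => tendsto_natCast_sub_add_div (k + s) 0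
    have h2 := h1.const_mul ((p.factorial : ℝ)⁻¹)
    rw [Finset.prod_const_one, mul_one] at h2
    refine h2.congr fun N => ?_
    have h3 : ((N - k).descFactorial p : ℝ) = p.factorial * (N - k).choose p := by
      exact_mod_cast Nat.descFactorial_eq_factorial_mul_choose _ _
    have h4 : ((N - k).descFactorial p : ℝ) = ∏ s ∈ Finset.range p, ((N - (k + s) : ℕ) : ℝ) := by
      rw [Nat.descFactorial_eq_prod_range]
      push_cast
      exact Finset.prod_congr rfl fun s _ => by rw [Nat.sub_sub]
    simp only [add_zero]
    rw [Finset.prod_div_distrib, Finset.prod_const, Finset.card_range, ← h4, h3]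
    field_simp

lemma tendsto_gaussTerm (α k : ℕ) (x y : ℝ) :
    Tendsto (fun N : ℕ => gaussTerm α N (N - k - α) x y) atTop
      (𝓝 (genSum (divDiff (divDiff (tensor (kernelCoeff α) (kernelCoeff α)))) x y)) := by
  have h : Tendsto (fun N : ℕ => genSum (divDiff (divDiff
      (tensor (scaledCoeff α N (N - k)) (scaledCoeff α N (N - k))))) x y) atTop
      (𝓝 (genSum (divDiff (divDiff (tensor (kernelCoeff α) (kernelCoeff α)))) x y)) :=
    tendsto_genSum zero_le_two
      (Eventually.of_forall fun N => factorialBound_scaledCoeff α (Nat.sub_le N k))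
      (tendsto_divDiff (tendsto_divDiff fun i j =>
        (tendsto_scaledCoeff α k i).mul (tendsto_scaledCoeff α k j))) x y
  refine h.congr' ?_
  filter_upwards [eventually_ge_atTop (k + α)] with N hN
  rw [gaussTerm, show N - k - α + α = N - k by omega]

lemma tendsto_factorial_ratio (α k : ℕ) :
    Tendsto (fun N : ℕ =>
      (N : ℝ) ^ α * (N - k - α + 2).factorial / ((N : ℝ) ^ 2 * (N - k).factorial))
      atTop (𝓝 1) := by
  have h1 : Tendsto (fun N : ℕ => ((((N - (k + α) : ℕ) : ℝ) + 1) / N *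
      ((((N - (k + α) : ℕ) : ℝ) + 2) / N)) /
      ∏ s ∈ Finset.range α, (((N - (k + α) : ℕ) : ℝ) + (1 + s)) / N) atTop
      (𝓝 (1 * 1 / ∏ s ∈ Finset.range α, 1)) :=
    ((tendsto_natCast_sub_add_div _ 1).mul (tendsto_natCast_sub_add_div _ 2)).div
      (tendsto_finsetProd _ fun s _ => tendsto_natCast_sub_add_div _ (1 + s)) (by simp)
  rw [Finset.prod_const_one, one_mul, div_one] at h1
  refine h1.congr' ?_
  filter_upwards [eventually_ge_atTop (k + α + 1)] with N hN
  obtain ⟨m, rfl⟩ : ∃ m, N = m + (k + α) := ⟨N - (k + α), by omega⟩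
  have hN' : ((m + (k + α) : ℕ) : ℝ) ≠ 0 := by
    have : m + (k + α) ≠ 0 := by omega
    exact_mod_cast this
  have e1 : m + (k + α) - (k + α) = m := by omega
  have e2 : m + (k + α) - k - α = m := by omega
  have e3 : m + (k + α) - k = m + α := by omega
  rw [e1, e2, e3, Finset.prod_div_distrib, Finset.prod_const, Finset.card_range]
  have h2 : ((m + α).factorial : ℝ) = m.factorial * ∏ s ∈ Finset.range α, ((m : ℝ) + (1 + s)) := by
    rw [← Nat.factorial_mul_ascFactorial, Nat.ascFactorial_eq_prod_range]
    push_cast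
    congr 1
    exact Finset.prod_congr rfl fun s _ => by ring
  have hf : ((m + 2).factorial : ℝ) = (m + 2) * ((m + 1) * m.factorial) := by
    rw [Nat.factorial_succ, Nat.factorial_succ]; push_cast; ring
  have h3 : ∏ s ∈ Finset.range α, ((m : ℝ) + (1 + s)) ≠ 0 :=
    Finset.prod_ne_zero_iff.mpr fun s _ => by positivity
  rw [h2, hf]
  field_simp

/-- The bound is uniform in `N` and polynomial in `k`. From `N = m + k + α ≤ (m + 1)(k + α + 1)`,
the power `(m + 1)^α` is absorbed by `(m + α)!`; the `6` comes from `(N + 2)(N + 1) ≤ 3N · 2N`. -/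
lemma factorial_ratio_le (α k : ℕ) {N : ℕ} (hN : k + α ≤ N) :
    (N : ℝ) ^ α * (N - k - α + 2).factorial / ((N : ℝ) ^ 2 * (N - k).factorial) ≤
      6 * (k + α + 1) ^ α := by
  obtain ⟨m, rfl⟩ : ∃ m, N = m + (k + α) := ⟨N - (k + α), by omega⟩
  have e2 : m + (k + α) - k - α = m := by omega
  have e3 : m + (k + α) - k = m + α := by omega
  rw [e2, e3]
  rcases Nat.eq_zero_or_pos (m + (k + α)) with h0 | h0
  -- At `N = 0` the quotient is `0`, being a division by `0`.
  · rw [h0]; simp; positivity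
  · have hN1 : (1 : ℝ) ≤ (m + (k + α) : ℕ) := by exact_mod_cast h0
    have hm : (m : ℝ) ≤ (m + (k + α) : ℕ) := by exact_mod_cast Nat.le_add_right _ _
    set N : ℝ := ((m + (k + α) : ℕ) : ℝ) with hNdef
    have hNe : N = m + (k + α) := by rw [hNdef]; push_cast; ring
    rw [div_le_iff₀ (by positivity)]
    have hf : ((m + 2).factorial : ℝ) = (m + 2) * ((m + 1) * m.factorial) := by
      rw [Nat.factorial_succ, Nat.factorial_succ]; push_cast; ring
    have h1 : N ^ α ≤ (m + 1 : ℝ) ^ α * (k + α + 1) ^ α := by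
      rw [← mul_pow]
      refine pow_le_pow_left₀ (by linarith) ?_ α
      rw [hNe]
      nlinarith [Nat.cast_nonneg (α := ℝ) m, Nat.cast_nonneg (α := ℝ) k,
        Nat.cast_nonneg (α := ℝ) α, mul_nonneg (Nat.cast_nonneg (α := ℝ) m)
          (add_nonneg (Nat.cast_nonneg (α := ℝ) k) (Nat.cast_nonneg (α := ℝ) α))]
    have h2 : (m.factorial : ℝ) * (m + 1 : ℝ) ^ α ≤ (m + α).factorial := by
      exact_mod_cast Nat.factorial_mul_pow_le_factorial
    have h3 : ((m : ℝ) + 2) * (m + 1) ≤ 6 * N ^ 2 := by nlinarith [Nat.cast_nonneg (α := ℝ) m]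
    calc N ^ α * ((m + 2).factorial : ℝ)
        ≤ ((m + 1 : ℝ) ^ α * (k + α + 1) ^ α) * (m + 2).factorial :=
          mul_le_mul_of_nonneg_right h1 (by positivity)
      _ = ((m + 2) * (m + 1)) * (m.factorial * (m + 1 : ℝ) ^ α) * (k + α + 1) ^ α := by
          rw [hf]; ring
      _ ≤ (6 * N ^ 2) * (m + α).factorial * (k + α + 1) ^ α := by gcongr
      _ = _ := by ring

lemma summable_pow_div_factorial_mul_pow (κ : ℝ) (α : ℕ) :
    Summable fun k : ℕ => |κ| ^ k / k.factorial * (k + α + 1 : ℝ) ^ α := by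
  have h := (Real.summable_pow_div_factorial (|κ| * Real.exp 1)).mul_left
    (α.factorial * Real.exp (α + 1))
  refine Summable.of_nonneg_of_le (fun k => by positivity) (fun k => ?_) h
  have h1 := Real.pow_div_factorial_le_exp (x := (k + α + 1 : ℝ)) (by positivity) α
  rw [div_le_iff₀ (by positivity)] at h1
  have h2 : Real.exp (k + α + 1) = Real.exp (α + 1) * Real.exp 1 ^ k := by
    rw [← Real.exp_nat_mul, ← Real.exp_add]; congr 1; ring
  rw [h2] at h1
  refine (mul_le_mul_of_nonneg_left h1 (by positivity)).trans (le_of_eq ?_)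
  rw [mul_pow]; ring

lemma tendsto_tsum_cumulantTerm (α : ℕ) (κ x y : ℝ) :
    Tendsto (fun N : ℕ => ∑' k, cumulantTerm α κ x y N k) atTop (𝓝 (Real.exp κ *
      genSum (divDiff (divDiff (tensor (kernelCoeff α) (kernelCoeff α)))) x y)) := by
  set g := genSum (divDiff (divDiff (tensor (kernelCoeff α) (kernelCoeff α)))) x y with hg
  -- `D` bounds every Gaussian term uniformly in `N` and `k`; its constants are those of
  -- `factorialBound_scaledCoeff`.
  set D : ℝ := ∑' p : ℕ × ℕ, 2 * 2 ^ 2 * (2 * 2 ^ 2 * 1) *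
    ((2 : ℝ) ^ (p.1 + p.2) / (p.1 + p.2).factorial) * max |x| |y| ^ (p.1 + p.2) with hD
  have hlim : ∑' k : ℕ, κ ^ k / k.factorial * 1 * g = Real.exp κ * g := by
    have := (NormedSpace.expSeries_div_hasSum_exp κ).mul_right g
    rw [Real.exp_eq_exp_ℝ, ← this.tsum_eq]
    simp
  rw [← hlim]
  refine tendsto_tsum_of_dominated_convergence
    (bound := fun k => |κ| ^ k / k.factorial * (k + α + 1 : ℝ) ^ α * (6 * D))
    ((summable_pow_div_factorial_mul_pow κ α).mul_right _) (fun k => ?_)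
    (Eventually.of_forall fun N k => ?_)
  · have h := ((tendsto_factorial_ratio α k).const_mul (κ ^ k / k.factorial)).mul
      (tendsto_gaussTerm α k x y)
    refine h.congr' ?_
    filter_upwards [eventually_ge_atTop (k + α)] with N hN
    rw [cumulantTerm, if_pos hN]
  · have hD0 : 0 ≤ D := tsum_nonneg fun p => by positivity
    rw [cumulantTerm]
    split_ifs with h
    · have hb : |gaussTerm α N (N - k - α) x y| ≤ D :=
        (factorialBound_scaledCoeff α (by omega)).abs_genSum_le zero_le_two x y
      rw [Real.norm_eq_abs, abs_mul, abs_mul, abs_div, abs_pow, Nat.abs_cast,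
        abs_of_nonneg (a := _ * _ / _) (by positivity)]
      calc _ ≤ |κ| ^ k / k.factorial * (6 * (k + α + 1) ^ α) * D := by
            gcongr
            exact factorial_ratio_le α k h
        _ = _ := by ring
    · rw [norm_zero]; positivity

/-! ### The limit theorem -/

lemma correlation_eq_genSum {Ω : Type*} [MeasurableSpace Ω] {P : Measure Ω} {Q : Measure ℝ}
    [IsProbabilityMeasure P] [IsProbabilityMeasure Q]
    (hQ4 : Integrable (fun x : ℝ => x ^ 4) Q) {b : ℝ} (h1 : ∫ x, x ∂Q = 0)
    (h2 : ∫ x, x ^ 2 ∂Q = 1) (h4 : ∫ x, x ^ 4 ∂Q = b) {n m : ℕ}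
    {X : Ω → Matrix (Fin n) (Fin m) ℝ} (hX : IsIIDMatrix P Q X) (μ ν : ℝ) :
    correlation P X μ ν = genSum (correlationCoeff (b - 3) n m) μ ν := by
  have hzero : ∀ (W : Matrix (Fin m) (Fin m) ℝ) i, m < i → W.charpoly.coeff i = 0 :=
    fun W i hi => Polynomial.coeff_eq_zero_of_natDegree_lt (by simpa using hi)
  rw [correlation_eq_sum hQ4 h1 h2 h4 hX, genSum,
    tsum_eq_sum (s := Finset.range (m + 1) ×ˢ Finset.range (m + 1)), Finset.sum_product]
  rintro ⟨i, j⟩ hij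
  rw [← meanCoeff_eq hQ4 h1 h2 h4 n m X hX]
  simp only [Finset.mem_product, Finset.mem_range, not_and_or, not_lt, Nat.succ_le_iff] at hij
  rcases hij with h | h <;> simp [meanCoeff, hzero _ _ h]

theorem theorem6p3
    (Q : Measure ℝ) [IsProbabilityMeasure Q] (b : ℝ)
    (hQ4 : Integrable (fun x : ℝ => x ^ 4) Q)
    (hmean : ∫ x, x ∂Q = 0)
    (hvar : variance (fun x : ℝ => x) Q = 1)
    (hb : ∫ x, x ^ 4 ∂Q = b)
    (α : ℕ)
    (Ω : ℕ → Type*) [∀ N, MeasurableSpace (Ω N)]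
    (P : ∀ N, Measure (Ω N)) [∀ N, IsProbabilityMeasure (P N)]
    (X : ∀ N, Ω N → Matrix (Fin N) (Fin (N - α)) ℝ)
    (hX : ∀ N, IsIIDMatrix (P N) Q (X N)) :
    -- the kernel is a continuous function, so that its values on the diagonal are genuine limits
    ContinuousOn (fun p : ℝ × ℝ => diffBesselKernel α p.1 p.2) (Set.Ici 0 ×ˢ Set.Ici 0) ∧
    ∀ μ ν : ℝ, 0 ≤ μ → 0 ≤ ν →
      -- the expectations exist
      (∀ N : ℕ, Integrable
        (fun ω => charProduct (X N ω) (μ / (4 * (N : ℝ))) (ν / (4 * (N : ℝ)))) (P N)) ∧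
      Tendsto
        (fun N : ℕ => (1 / 16 : ℝ) * ((N : ℝ) ^ 2)⁻¹ * hardEdgeFactor α N (μ / 4) (ν / 4) *
          (correlation (P N) (X N) (μ / (4 * (N : ℝ))) (ν / (4 * (N : ℝ))) /
            ((N.factorial : ℝ) * ((N - α).factorial : ℝ))))
        atTop (𝓝 (Real.exp (b - 3) * diffBesselKernel α μ ν)) := by
  have h2 : ∫ x, x ^ 2 ∂Q = 1 := by
    rw [← hvar, variance_eq_integral (by fun_prop), hmean]
    simp
  refine ⟨?_, fun μ ν hμ hν => ⟨fun N => integrable_charProduct hQ4 (hX N) _ _, ?_⟩⟩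
  · refine (continuous_kernelSeries α).continuousOn.congr fun p hp => ?_
    exact diffBesselKernel_eq hp.1 hp.2
  · rw [diffBesselKernel_eq hμ hν, kernelSeries]
    have h := (tendsto_tsum_cumulantTerm α (b - 3) μ ν).const_mul
      (16 * (μ * ν / 16) ^ ((α : ℝ) / 2))
    have hval : Real.exp (b - 3) * (16 * (μ * ν / 16) ^ ((α : ℝ) / 2) *
        genSum (divDiff (divDiff (tensor (kernelCoeff α) (kernelCoeff α)))) μ ν) =
        16 * (μ * ν / 16) ^ ((α : ℝ) / 2) * (Real.exp (b - 3) *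
        genSum (divDiff (divDiff (tensor (kernelCoeff α) (kernelCoeff α)))) μ ν) := by ring
    rw [hval]
    refine h.congr' ?_
    filter_upwards [eventually_ge_atTop (α + 1)] with N hN
    have hN0 : 0 < N := by omega
    have hN' : (N : ℝ) ≠ 0 := by positivity
    -- The factor `N^α` here cancels the one in `genSum_correlationCoeff`, and `256/16 = 16` is the
    -- constant of `kernelSeries`.
    have hZ : hardEdgeFactor α N (μ / 4) (ν / 4) =
        (μ * ν / 16) ^ ((α : ℝ) / 2) / (N : ℝ) ^ α := by
      rw [hardEdgeFactor, show μ / 4 * (ν / 4) / (N : ℝ) ^ 2 = μ * ν / 16 / (N : ℝ) ^ 2 by ring,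
        Real.div_rpow (by positivity) (by positivity),
        Real.rpow_div_two_eq_sqrt (x := (N : ℝ) ^ 2) _ (by positivity),
        Real.sqrt_sq (Nat.cast_nonneg N), Real.rpow_natCast]
    rw [correlation_eq_genSum hQ4 hmean h2 hb (hX N), div_eq_mul_inv μ (4 * (N : ℝ)),
      div_eq_mul_inv ν (4 * (N : ℝ)), genSum_correlationCoeff α (b - 3) μ ν (by omega) hN0, hZ]
    have hf1 : (N.factorial : ℝ) ≠ 0 := by positivity
    have hf2 : ((N - α).factorial : ℝ) ≠ 0 := by positivity
    field_simp
    ring
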